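/- Let $T_1<T_2$ be real numbers, let $P,Q\in C([T_1,T_2])$ with $P>0$ and $Q\ge 0$ on $[T_1,T_2]$, and put $Lu:=-(P(t)u')'+Q(t)u$. For $m,n\in C([T_1,T_2])$, both $\not\equiv 0$, consider the Neumann problem $$Lu=a\,m(t)u^+-b\,n(t)u^-\ \text{ in } ]T_1,T_2[,\qquad u'(T_1)=0=u'(T_2),\qquad u^{\pm}=\max\{\pm u,0\}.\tag{$*$}$$ For $k\ge 1$ let $C_k^>$ (resp. $C_k^<$) be the set of $(a,b)\in\mathbb R^2$ for which $(*)$ has a nontrivial solution $u$ with exactly $k$ zeros in $]T_1,T_2[$ and $u(T_2)>0$ (resp. $u(T_2)<0$), and let $\Sigma^*:=\bigcup_{k\ge1}(C_k^>\cup C_k^<)$ (the Fučík spectrum of $(*)$ without its trivial lines). For signs $\varepsilon_1,\varepsilon_2\in\{+,-\}$, where $\mathbb R_+=[0,+\infty[$ and $\mathbb R_-=]-\infty,0]$, a hyperbolic-like curve in the quadrant $\mathbb R_{\varepsilon_1}\times\mathbb R_{\varepsilon_2}$ is a set of the form $\{(\varepsilon_1 t,\varepsilon_2 f(t)) : t>\alpha\}$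 with $\alpha,\beta\ge 0$ and $f:\,]\alpha,+\infty[\,\to\,]\beta,+\infty[$ a strictly decreasing $C^1$-diffeomorphism. We say that $\Sigma^*$ contains exactly $N\in\mathbb N\cup\{+\infty\}$ hyperbolic-like curves in this quadrant if every nonempty intersection $C_k^{>}\cap(\mathbb R_{\varepsilon_1}\times\mathbb R_{\varepsilon_2})$ or $C_k^{<}\cap(\mathbb R_{\varepsilon_1}\times\mathbb R_{\varepsilon_2})$, $k\ge1$, is a hyperbolic-like curve in it and the number of these nonempty intersections (so that coinciding ones are counted with multiplicity) is $N$. Theorem 5. For all $p,q,r,s\in\mathbb N\cup\{+\infty\}$ there exist continuous weights $m,n$ on $[T_1,T_2]$, both $\not\equiv0$, such that $\Sigma^*$ contains exactly $2p+1$, $2q+1$, $2r+1$ and $2s+1$ hyperbolic-like curves in the quadrants $\mathbb R_+\times\mathbb R_+$, $\mathbb R_+\times\mathbb R_-$, $\mathbb R_-\times\mathbb R_-$ and $\mathbb R_-\times\mathbb R_+$ respectively. -/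

import Mathlib

open Set

/-- `u` is a (classical) solution on `[T₁, T₂]` of the Neumann problem
`-(p u')' + q u = a m u⁺ - b n u⁻`, `u'(T₁) = 0 = u'(T₂)`, where `u⁺ = max u 0` and
`u⁻ = max (-u) 0`. The function `w` is the derivative `u'`; derivatives are one-sided at the end
points. (The equation at the end points is automatic from the equation inside, as all the
coefficients are continuous on `[T₁, T₂]`.) -/
def IsNeumannSolution (T₁ T₂ : ℝ) (p q m n : ℝ → ℝ) (a b : ℝ) (u : ℝ → ℝ) : Prop :=
  ∃ w : ℝ → ℝ,
    (∀ t ∈ Icc T₁ T₂, HasDerivWithinAt u (w t) (Icc T₁ T₂) t) ∧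
    (∀ t ∈ Icc T₁ T₂, HasDerivWithinAt (fun x => p x * w x)
      (q t * u t - (a * m t * max (u t) 0 - b * n t * max (-u t) 0)) (Icc T₁ T₂) t) ∧
    w T₁ = 0 ∧ w T₂ = 0

/-- The piece `C_k^σ` of the Fučík spectrum (`σ = 1` for `C_k^>`, `σ = -1` for `C_k^<`): the set
of all `(a, b)` for which the Neumann problem has a solution with exactly `k` zeros in
`]T₁, T₂[` that ends with the sign `σ`, i.e. `u(T₂) > 0` if `σ = 1` and `u(T₂) < 0` if `σ = -1`
(so that `u` is nontrivial). -/
def fucikPiece (T₁ T₂ : ℝ) (p q m n : ℝ → ℝ) (k : ℕ) (σ : ℤˣ) : Set (ℝ × ℝ) :=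
  {x | ∃ u : ℝ → ℝ, IsNeumannSolution T₁ T₂ p q m n x.1 x.2 u ∧
    {t ∈ Ioo T₁ T₂ | u t = 0}.encard = k ∧ 0 < ((σ : ℤ) : ℝ) * u T₂}

/-- The Fučík spectrum without its trivial lines: `Σ* = ⋃_{k ≥ 1} (C_k^> ∪ C_k^<)`. -/
def fucikStar (T₁ T₂ : ℝ) (p q m n : ℝ → ℝ) : Set (ℝ × ℝ) :=
  ⋃ k : ℕ, ⋃ _ : 1 ≤ k, fucikPiece T₁ T₂ p q m n k 1 ∪ fucikPiece T₁ T₂ p q m n k (-1)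

/-- The quadrant `ℝ_{ε₁} × ℝ_{ε₂}` of the plane. -/
def quadrant (ε₁ ε₂ : ℤˣ) : Set (ℝ × ℝ) :=
  {x | 0 ≤ ((ε₁ : ℤ) : ℝ) * x.1 ∧ 0 ≤ ((ε₂ : ℤ) : ℝ) * x.2}

/-- Hyperbolic-like curves of the quadrant `(ε₁, ε₂)`: up to the reflections that carry the
quadrant to `(+, +)`, the graph of a strictly decreasing `C¹`-diffeomorphism `f` of a half-line
`]α, +∞[` onto a half-line `]β, +∞[`; `g` is the inverse of `f`. -/
def IsHyperbolicLike (ε₁ ε₂ : ℤˣ) (S : Set (ℝ × ℝ)) : Prop :=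
  ∃ (α β : ℝ) (f g : ℝ → ℝ), 0 ≤ α ∧ 0 ≤ β ∧
    MapsTo f (Ioi α) (Ioi β) ∧ MapsTo g (Ioi β) (Ioi α) ∧ InvOn g f (Ioi α) (Ioi β) ∧
    ContDiffOn ℝ 1 f (Ioi α) ∧ ContDiffOn ℝ 1 g (Ioi β) ∧ StrictAntiOn f (Ioi α) ∧
    S = (fun t => (((ε₁ : ℤ) : ℝ) * t, ((ε₂ : ℤ) : ℝ) * f t)) '' Ioi α

/-- The indices `(k, σ)`, `k ≥ 1`, of the pieces `C_k^σ` that meet the quadrant `(ε₁, ε₂)`. -/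
def curveIndices (T₁ T₂ : ℝ) (p q m n : ℝ → ℝ) (ε₁ ε₂ : ℤˣ) : Set (ℕ × ℤˣ) :=
  {i | 1 ≤ i.1 ∧ (fucikPiece T₁ T₂ p q m n i.1 i.2 ∩ quadrant ε₁ ε₂).Nonempty}

/-- In the quadrant `(ε₁, ε₂)`, `Σ*` consists of exactly `N` hyperbolic-like curves
`C_k^σ ∩ (ℝ_{ε₁} × ℝ_{ε₂})`. The curves are counted by their indices `(k, σ)`: when `C_k^>` and
`C_k^<` coincide there, the curve is double and counts for two. -/
def HasExactlyCurves (T₁ T₂ : ℝ) (p q m n : ℝ → ℝ) (ε₁ ε₂ : ℤˣ) (N : ℕ∞) : Prop :=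
  fucikStar T₁ T₂ p q m n ∩ quadrant ε₁ ε₂ =
      ⋃ i ∈ curveIndices T₁ T₂ p q m n ε₁ ε₂,
        fucikPiece T₁ T₂ p q m n i.1 i.2 ∩ quadrant ε₁ ε₂ ∧
    (∀ i ∈ curveIndices T₁ T₂ p q m n ε₁ ε₂,
      IsHyperbolicLike ε₁ ε₂ (fucikPiece T₁ T₂ p q m n i.1 i.2 ∩ quadrant ε₁ ε₂)) ∧
    (curveIndices T₁ T₂ p q m n ε₁ ε₂).encard = N

/-! Write u = ρ sin θ and P u' = ρ cos θ. The equation decouples: θ' = 1/P + (a m − d)(sin⁺ θ)² + (b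
n − d)(sin⁻ θ)² with d = 1/P + Q, and ρ follows by integration. The Neumann conditions say that θ
lies in πℤ + π/2 at both ends, and each zero of u is an upward passage of θ through πℤ. Let θ start
at (j − k)π + π/2, where j = 0 or −1 according to the final sign. Then C_k^σ is the level set θ(T₂)
= jπ + π/2 in the (a, b)-plane (`mem_fucikPiece_iff`). Moving the signs of a and b into m and n
reduces every quadrant to the first.

Shape: on the level set both partial derivatives of θ(T₂) are positive. The one in a is a positive
multiple of ∫ m (u⁺)², and testing the equation with u⁺ gives a ∫ m (u⁺)² = ∫ P ((u⁺)')² + Q (u⁺)² >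
0 (`IsPruferAngle.integral_pos`). On the half-axes θ(T₂) stays below the level. The intermediate
value theorem and implicit differentiation then make a nonempty level set a hyperbolic-like curve
(`IsCrossingUpwards.isHyperbolicLike`).

Nonemptiness: at the angle iπ + π/2 the speed is a m − Q for even i and b n − Q for odd i, so this
angle can be passed only where the weight in charge is positive. A curve with index k thus needs k +
1 successive points at which the weights, with the signs of the quadrant, are alternately positive.
Conversely, near each such point the angle makes a half turn once a = b is large
(`fucikPiece_inter_quadrant`).

Combinatorics: the count depends only on the order in which intervals with m > 0, m < 0, n > 0, n <
0 occur. If the two relevant kinds alternate N + 1 times, the longest chains have lengths N + 2 and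
N + 1 according to their last kind, which gives (N + 1) + N curves. Repeating two kinds adds
alternations to one quadrant only, provided that the quadrants sharing one kind already end with it;
an interval on which both weights are nonzero adds infinitely many. Short words fix the parities
(`exists_reachable`). -/

/-! ### Squared parts of the sine and their difference quotients -/

/-- The square of the positive part of the sine. -/
noncomputable def sinPosSq (x : ℝ) : ℝ := max (Real.sin x) 0 ^ 2

/-- The square of the negative part of the sine. -/
noncomputable def sinNegSq (x : ℝ) : ℝ := sinPosSq (x + Real.pi)

/-- The derivative of `sinPosSq`. -/
noncomputable def sinPosSqDeriv (x : ℝ) : ℝ := 2 * max (Real.sin x) 0 * Real.cos x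

/-- The difference quotient of `sinPosSq`, as a continuous function of both end points. -/
noncomputable def sinPosSqQuot (x y : ℝ) : ℝ := ∫ s in (0 : ℝ)..1, sinPosSqDeriv (x + s * (y - x))

/-- The difference quotient of `sinNegSq`. -/
noncomputable def sinNegSqQuot (x y : ℝ) : ℝ := sinPosSqQuot (x + Real.pi) (y + Real.pi)

theorem hasDerivAt_max_zero_sq (x : ℝ) : HasDerivAt (fun y : ℝ => max y 0 ^ 2) (2 * max x 0) x := by
  rcases lt_trichotomy x 0 with h | h | h
  · rw [max_eq_right h.le, mul_zero]
    refine (hasDerivAt_const x (0 : ℝ)).congr_of_eventuallyEq ?_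
    filter_upwards [Iio_mem_nhds h] with y hy
    simp [max_eq_right (mem_Iio.1 hy).le]
  · subst h
    rw [hasDerivAt_iff_isLittleO]
    simp only [max_self, mul_zero, smul_zero, sub_zero, ne_eq, OfNat.ofNat_ne_zero,
      not_false_eq_true, zero_pow]
    refine Asymptotics.IsBigO.trans_isLittleO (g := fun y : ℝ => y ^ 2) ?_ ?_
    · refine Asymptotics.IsBigO.of_bound 1 (Filter.Eventually.of_forall fun y => ?_)
      rw [one_mul, Real.norm_eq_abs, Real.norm_eq_abs, abs_of_nonneg (sq_nonneg _),
        abs_of_nonneg (sq_nonneg _)]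
      rcases le_total y 0 with h | h
      · simp [max_eq_right h, sq_nonneg]
      · simp [max_eq_left h]
    · simpa using Asymptotics.isLittleO_pow_pow (𝕜 := ℝ) (m := 1) (n := 2) (by norm_num)
  · rw [max_eq_left h.le]
    refine (by simpa using hasDerivAt_pow 2 x : HasDerivAt (fun y : ℝ => y ^ 2) (2 * x) x)
      |>.congr_of_eventuallyEq ?_
    filter_upwards [Ioi_mem_nhds h] with y hy
    simp [max_eq_left (mem_Ioi.1 hy).le]

theorem hasDerivAt_sinPosSq (x : ℝ) : HasDerivAt sinPosSq (sinPosSqDeriv x) x :=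
  (hasDerivAt_max_zero_sq (Real.sin x)).comp x (Real.hasDerivAt_sin x)

theorem continuous_sinPosSqDeriv : Continuous sinPosSqDeriv := by
  unfold sinPosSqDeriv; fun_prop

theorem continuous_sinPosSq : Continuous sinPosSq := by
  unfold sinPosSq; fun_prop

theorem continuous_sinNegSq : Continuous sinNegSq := by
  unfold sinNegSq; exact continuous_sinPosSq.comp (by fun_prop)

theorem continuous_sinPosSqQuot : Continuous (fun z : ℝ × ℝ => sinPosSqQuot z.1 z.2) := by
  unfold sinPosSqQuot
  apply intervalIntegral.continuous_parametric_intervalIntegral_of_continuous'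
  exact continuous_sinPosSqDeriv.comp (by fun_prop)

theorem continuous_sinNegSqQuot : Continuous (fun z : ℝ × ℝ => sinNegSqQuot z.1 z.2) := by
  unfold sinNegSqQuot
  exact continuous_sinPosSqQuot.comp
    (f := fun z : ℝ × ℝ => (z.1 + Real.pi, z.2 + Real.pi)) (by fun_prop)

theorem abs_sinPosSqDeriv_le (x : ℝ) : |sinPosSqDeriv x| ≤ 2 := by
  unfold sinPosSqDeriv
  rw [abs_mul, abs_mul, abs_two]
  have h1 : |max (Real.sin x) 0| ≤ 1 := by
    rw [abs_of_nonneg (le_max_right _ _)]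
    exact max_le (Real.sin_le_one x) zero_le_one
  have h2 := Real.abs_cos_le_one x
  nlinarith [abs_nonneg (max (Real.sin x) 0), abs_nonneg (Real.cos x)]

theorem abs_sinPosSqQuot_le (x y : ℝ) : |sinPosSqQuot x y| ≤ 2 := by
  have := intervalIntegral.norm_integral_le_of_norm_le_const (a := (0 : ℝ)) (b := 1) (C := 2)
    (f := fun s => sinPosSqDeriv (x + s * (y - x)))
    (fun s _ => abs_sinPosSqDeriv_le _)
  simpa [sinPosSqQuot] using this

theorem abs_sinNegSqQuot_le (x y : ℝ) : |sinNegSqQuot x y| ≤ 2 := abs_sinPosSqQuot_le _ _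

/-- The fundamental theorem of calculus along the segment from `x` to `y`. As the identity is exact
and the quotient continuous, the difference of two Prüfer angles solves a linear equation. -/
theorem sinPosSq_sub (x y : ℝ) : sinPosSq y - sinPosSq x = sinPosSqQuot x y * (y - x) := by
  have h : ∀ s ∈ uIcc (0 : ℝ) 1, HasDerivAt (fun s => sinPosSq (x + s * (y - x)))
      (sinPosSqDeriv (x + s * (y - x)) * (y - x)) s := by
    intro s _
    have h1 : HasDerivAt (fun s : ℝ => x + s * (y - x)) (y - x) s := by
      simpa using ((hasDerivAt_id s).mul_const (y - x)).const_add x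
    exact (hasDerivAt_sinPosSq _).comp s h1
  have h2 := intervalIntegral.integral_eq_sub_of_hasDerivAt h
    (Continuous.intervalIntegrable
      ((continuous_sinPosSqDeriv.comp (by fun_prop)).mul continuous_const) _ _)
  rw [intervalIntegral.integral_mul_const] at h2
  simp only [one_mul, zero_mul, add_zero, add_sub_cancel] at h2
  exact h2.symm

theorem sinNegSq_sub (x y : ℝ) : sinNegSq y - sinNegSq x = sinNegSqQuot x y * (y - x) := by
  unfold sinNegSq sinNegSqQuot
  rw [sinPosSq_sub]; ring

theorem sinPosSqQuot_self (x : ℝ) : sinPosSqQuot x x = sinPosSqDeriv x := by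
  simp [sinPosSqQuot]

theorem sinNegSqQuot_self (x : ℝ) : sinNegSqQuot x x = sinPosSqDeriv (x + Real.pi) := by
  simp [sinNegSqQuot, sinPosSqQuot_self]

theorem sinPosSq_nonneg (x : ℝ) : 0 ≤ sinPosSq x := sq_nonneg _

theorem sinPosSq_le_one (x : ℝ) : sinPosSq x ≤ 1 := by
  unfold sinPosSq
  exact pow_le_one₀ (le_max_right _ _) (max_le (Real.sin_le_one x) zero_le_one)

theorem sinNegSq_nonneg (x : ℝ) : 0 ≤ sinNegSq x := sq_nonneg _

theorem sinNegSq_le_one (x : ℝ) : sinNegSq x ≤ 1 := sinPosSq_le_one _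

theorem sinNegSq_eq (x : ℝ) : sinNegSq x = max (-Real.sin x) 0 ^ 2 := by
  simp [sinNegSq, sinPosSq, Real.sin_add_pi]

theorem sinPosSq_add_two_pi (x : ℝ) : sinPosSq (x + 2 * Real.pi) = sinPosSq x := by
  simp [sinPosSq]

theorem sinPosSq_add_int_mul_pi (x : ℝ) (j : ℤ) :
    sinPosSq (x + j * Real.pi) = if Even j then sinPosSq x else sinNegSq x := by
  rcases Int.even_or_odd' j with ⟨i, rfl | rfl⟩
  · rw [if_pos (even_two_mul i)]
    unfold sinPosSq
    have : x + ((2 * i : ℤ) : ℝ) * Real.pi = x + i * (2 * Real.pi) := by push_cast; ring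
    rw [this, Real.sin_add_int_mul_two_pi]
  · rw [if_neg (by simp)]
    unfold sinNegSq sinPosSq
    have : x + ((2 * i + 1 : ℤ) : ℝ) * Real.pi = x + Real.pi + i * (2 * Real.pi) := by
      push_cast; ring
    rw [this, Real.sin_add_int_mul_two_pi]

theorem sinNegSq_add_int_mul_pi (x : ℝ) (j : ℤ) :
    sinNegSq (x + j * Real.pi) = if Even j then sinNegSq x else sinPosSq x := by
  have h : sinNegSq (x + j * Real.pi) = sinPosSq (x + Real.pi + j * Real.pi) := by
    unfold sinNegSq; congr 1; ring
  rw [h, sinPosSq_add_int_mul_pi]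
  split_ifs with h
  · rfl
  · unfold sinNegSq; rw [← sinPosSq_add_two_pi x]; congr 1; ring

/-! ### Global existence of Prüfer angles -/

/-- `θ` is a Prüfer angle: a global solution of `θ' = c + A (sin⁺ θ)² + B (sin⁻ θ)²`. -/
def IsPruferAngle (c A B θ : ℝ → ℝ) : Prop :=
  ∀ t, HasDerivAt θ (c t + A t * sinPosSq (θ t) + B t * sinNegSq (θ t)) t

theorem IsPruferAngle.continuous {c A B θ : ℝ → ℝ} (h : IsPruferAngle c A B θ) : Continuous θ :=
  continuous_iff_continuousAt.2 fun t => (h t).continuousAt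

theorem exists_abs_le_on_Icc {f : ℝ → ℝ} (hf : Continuous f) (a b : ℝ) :
    ∃ C, 0 ≤ C ∧ ∀ t ∈ Icc a b, |f t| ≤ C := by
  obtain ⟨C, hC⟩ := (isCompact_Icc (a := a) (b := b)).exists_bound_of_continuousOn hf.continuousOn
  exact ⟨max C 0, le_max_right _ _, fun t ht => (hC t ht).trans (le_max_left _ _)⟩

theorem prufer_field_lipschitz {c A B : ℝ → ℝ} (hA : Continuous A)
    (hB : Continuous B) (a b : ℝ) : ∃ K : NNReal, ∀ t ∈ Icc a b,
      LipschitzOnWith K (fun x => c t + A t * sinPosSq x + B t * sinNegSq x) univ := by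
  obtain ⟨CA, hA0, hCA⟩ := exists_abs_le_on_Icc hA a b
  obtain ⟨CB, hB0, hCB⟩ := exists_abs_le_on_Icc hB a b
  refine ⟨NNReal.mk (CA * 2 + CB * 2) (by positivity), fun t ht => ?_⟩
  refine LipschitzOnWith.of_dist_le_mul fun x _ y _ => ?_
  rw [Real.dist_eq, Real.dist_eq, NNReal.coe_mk]
  have : c t + A t * sinPosSq x + B t * sinNegSq x - (c t + A t * sinPosSq y + B t * sinNegSq y)
      = (A t * sinPosSqQuot y x + B t * sinNegSqQuot y x) * (x - y) := by
    linear_combination A t * sinPosSq_sub y x + B t * sinNegSq_sub y x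
  rw [this, abs_mul]
  refine mul_le_mul_of_nonneg_right ((abs_add_le _ _).trans ?_) (abs_nonneg _)
  rw [abs_mul, abs_mul]
  exact add_le_add
    (mul_le_mul (hCA t ht) (abs_sinPosSqQuot_le _ _) (abs_nonneg _) hA0)
    (mul_le_mul (hCB t ht) (abs_sinNegSqQuot_le _ _) (abs_nonneg _) hB0)

theorem exists_prufer_angle_on_Ioo {c A B : ℝ → ℝ} (hc : Continuous c) (hA : Continuous A)
    (hB : Continuous B) (t₀ x₀ R : ℝ) (hR : 0 < R) : ∃ θ : ℝ → ℝ, θ t₀ = x₀ ∧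
      ∀ t ∈ Ioo (t₀ - R) (t₀ + R),
        HasDerivAt θ (c t + A t * sinPosSq (θ t) + B t * sinNegSq (θ t)) t := by
  obtain ⟨Cc, hc0, hCc⟩ := exists_abs_le_on_Icc hc (t₀ - R) (t₀ + R)
  obtain ⟨CA, hA0, hCA⟩ := exists_abs_le_on_Icc hA (t₀ - R) (t₀ + R)
  obtain ⟨CB, hB0, hCB⟩ := exists_abs_le_on_Icc hB (t₀ - R) (t₀ + R)
  obtain ⟨K, hK⟩ := prufer_field_lipschitz (c := c) hA hB (t₀ - R) (t₀ + R)
  have ht₀ : t₀ ∈ Icc (t₀ - R) (t₀ + R) := ⟨by linarith, by linarith⟩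
  -- The field is bounded in `x` by `Cc + CA + CB`, so a solution cannot leave the ball of radius
  -- `R` times this bound, and Picard–Lindelöf covers the whole time interval.
  have hpl : IsPicardLindelof (fun t x => c t + A t * sinPosSq x + B t * sinNegSq x)
      (⟨t₀, ht₀⟩ : Icc (t₀ - R) (t₀ + R)) x₀
      (NNReal.mk ((Cc + CA + CB) * R) (by positivity)) 0
      (NNReal.mk (Cc + CA + CB) (by positivity)) K := by
    refine ⟨fun t ht => (hK t ht).mono (subset_univ _), fun x _ => ?_, fun t ht x _ => ?_, ?_⟩
    · fun_prop
    · rw [Real.norm_eq_abs, NNReal.coe_mk]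
      have h1 : |A t * sinPosSq x| ≤ CA := by
        rw [abs_mul, abs_of_nonneg (sinPosSq_nonneg x)]
        exact (mul_le_of_le_one_right (abs_nonneg _) (sinPosSq_le_one x)).trans (hCA t ht)
      have h2 : |B t * sinNegSq x| ≤ CB := by
        rw [abs_mul, abs_of_nonneg (sinNegSq_nonneg x)]
        exact (mul_le_of_le_one_right (abs_nonneg _) (sinNegSq_le_one x)).trans (hCB t ht)
      exact (abs_add_le _ _).trans (add_le_add ((abs_add_le _ _).trans
        (add_le_add (hCc t ht) h1)) h2)
    · simp
  obtain ⟨θ, h0, hθ⟩ := hpl.exists_eq_forall_mem_Icc_hasDerivWithinAt₀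
  exact ⟨θ, h0, fun t ht => (hθ t (Ioo_subset_Icc_self ht)).hasDerivAt
    (Icc_mem_nhds ht.1 ht.2)⟩

theorem exists_prufer_angle {c A B : ℝ → ℝ} (hc : Continuous c) (hA : Continuous A)
    (hB : Continuous B) (t₀ x₀ : ℝ) : ∃ θ : ℝ → ℝ, θ t₀ = x₀ ∧ IsPruferAngle c A B θ := by
  choose α h0 hα using fun R : ℕ =>
    exists_prufer_angle_on_Ioo hc hA hB t₀ x₀ (R + 1 : ℝ) (by positivity)
  have huniq : ∀ R R' : ℕ, R ≤ R' → EqOn (α R) (α R') (Ioo (t₀ - (R + 1)) (t₀ + (R + 1))) := by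
    intro R R' h
    have h' : (R : ℝ) ≤ R' := by exact_mod_cast h
    obtain ⟨K, hK⟩ := prufer_field_lipschitz (c := c) hA hB (t₀ - (R + 1)) (t₀ + (R + 1))
    refine ODE_solution_unique_of_mem_Ioo (s := fun _ => univ) (t₀ := t₀)
      (fun t ht => hK t (Ioo_subset_Icc_self ht)) ⟨by linarith, by linarith⟩
      (fun t ht => ⟨hα R t ht, mem_univ _⟩)
      (fun t ht => ⟨hα R' t ⟨?_, ?_⟩, mem_univ _⟩) (by rw [h0, h0])
    · linarith [ht.1]
    · linarith [ht.2]
  have hmem : ∀ t : ℝ, ∀ R : ℕ, ⌈|t - t₀|⌉₊ ≤ R → t ∈ Ioo (t₀ - (R + 1)) (t₀ + (R + 1)) := by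
    intro t R h
    have h1 := Nat.le_ceil |t - t₀|
    have h2 : (⌈|t - t₀|⌉₊ : ℝ) ≤ R := by exact_mod_cast h
    have h3 := abs_le.1 (h1.trans h2)
    constructor <;> linarith [h3.1, h3.2]
  have heq : ∀ t : ℝ, ∀ R : ℕ, t ∈ Ioo (t₀ - (R + 1)) (t₀ + (R + 1)) →
      α ⌈|t - t₀|⌉₊ t = α R t := by
    intro t R h
    rcases le_total ⌈|t - t₀|⌉₊ R with h' | h'
    · exact huniq _ _ h' (hmem t _ le_rfl)
    · exact (huniq _ _ h' h).symm
  -- Local solutions agree on common intervals, so any index large enough for `t` gives the same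
  -- value.
  refine ⟨fun t => α ⌈|t - t₀|⌉₊ t, h0 _, fun t => ?_⟩
  refine (hα _ t (hmem t _ le_rfl)).congr_of_eventuallyEq ?_
  filter_upwards [isOpen_Ioo.mem_nhds (hmem t _ le_rfl)] with r hr
  exact heq r _ hr

/-! ### Linear scalar equations by the integrating factor -/

section LinearComparison

variable {e G h : ℝ → ℝ} {s₀ s : ℝ}

theorem hasDerivAt_exp_neg_integral (hG : Continuous G) (s₀ t : ℝ) :
    HasDerivAt (fun t => Real.exp (-∫ r in s₀..t, G r))
      (-G t * Real.exp (-∫ r in s₀..t, G r)) t := by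
  have h1 : HasDerivAt (fun t => ∫ r in s₀..t, G r) (G t) t :=
    intervalIntegral.integral_hasDerivAt_right (hG.intervalIntegrable _ _)
      (hG.stronglyMeasurableAtFilter _ _) hG.continuousAt
  have h2 := h1.neg.exp
  rwa [mul_comm] at h2

theorem hasDerivAt_mul_integrating_factor (hG : Continuous G)
    (he : ∀ t, HasDerivAt e (G t * e t + h t) t) (s₀ t : ℝ) :
    HasDerivAt (fun t => e t * Real.exp (-∫ r in s₀..t, G r))
      (h t * Real.exp (-∫ r in s₀..t, G r)) t := by
  convert! (he t).mul (hasDerivAt_exp_neg_integral hG s₀ t) using 1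
  ring

/-- The integrating factor is positive, so a sign of `h` becomes monotonicity of a positive multiple
of `e`. -/
theorem linear_comparison_nonneg (hG : Continuous G)
    (he : ∀ t, HasDerivAt e (G t * e t + h t) t) (hs : s₀ ≤ s)
    (hh : ∀ t ∈ Ioo s₀ s, 0 ≤ h t) :
    e s₀ ≤ e s * Real.exp (-∫ r in s₀..s, G r) := by
  have hd := hasDerivAt_mul_integrating_factor hG he s₀
  have hm : MonotoneOn (fun t => e t * Real.exp (-∫ r in s₀..t, G r)) (Icc s₀ s) := by
    refine monotoneOn_of_deriv_nonneg (convex_Icc _ _)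
      (fun t _ => (hd t).continuousAt.continuousWithinAt)
      (fun t _ => (hd t).differentiableAt.differentiableWithinAt) fun t ht => ?_
    rw [interior_Icc] at ht
    rw [(hd t).deriv]
    exact mul_nonneg (hh t ht) (Real.exp_pos _).le
  simpa using hm (left_mem_Icc.2 hs) (right_mem_Icc.2 hs) hs

theorem linear_comparison_pos (hG : Continuous G)
    (he : ∀ t, HasDerivAt e (G t * e t + h t) t) (hs : s₀ < s)
    (hh : ∀ t ∈ Ioo s₀ s, 0 < h t) :
    e s₀ < e s * Real.exp (-∫ r in s₀..s, G r) := by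
  have hd := hasDerivAt_mul_integrating_factor hG he s₀
  have hm : StrictMonoOn (fun t => e t * Real.exp (-∫ r in s₀..t, G r)) (Icc s₀ s) := by
    refine strictMonoOn_of_deriv_pos (convex_Icc _ _)
      (fun t _ => (hd t).continuousAt.continuousWithinAt) fun t ht => ?_
    rw [interior_Icc] at ht
    rw [(hd t).deriv]
    exact mul_pos (hh t ht) (Real.exp_pos _)
  simpa using hm (left_mem_Icc.2 hs.le) (right_mem_Icc.2 hs.le) hs

theorem linear_variation_of_constants (hG : Continuous G) (hh : Continuous h)
    (he : ∀ t, HasDerivAt e (G t * e t + h t) t) (h0 : e s₀ = 0) (s : ℝ) :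
    e s = Real.exp (∫ r in s₀..s, G r) *
      ∫ t in s₀..s, h t * Real.exp (-∫ r in s₀..t, G r) := by
  have hd := hasDerivAt_mul_integrating_factor hG he s₀
  have hE : Continuous fun t => Real.exp (-∫ r in s₀..t, G r) :=
    continuous_iff_continuousAt.2 fun t => (hasDerivAt_exp_neg_integral hG s₀ t).continuousAt
  rw [intervalIntegral.integral_eq_sub_of_hasDerivAt (fun t _ => hd t)
    ((hh.mul hE).intervalIntegrable _ _), h0, zero_mul, sub_zero, Real.exp_neg]
  field_simp

end LinearComparison

/-! ### Angles that can be passed only upwards, or only where a weight is positive -/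

section Barriers

variable {c A B A' B' θ η : ℝ → ℝ} {s₀ s : ℝ}

/-- The coefficient that governs the angles in `[jπ, (j+1)π]`. -/
def parityCoeff (A B : ℝ → ℝ) (j : ℤ) : ℝ → ℝ := if Even j then A else B

theorem IsPruferAngle.hasDerivAt_sub (hθ : IsPruferAngle c A B θ) (hη : IsPruferAngle c A' B' η)
    (t : ℝ) : HasDerivAt (fun t => η t - θ t)
      ((A t * sinPosSqQuot (θ t) (η t) + B t * sinNegSqQuot (θ t) (η t)) * (η t - θ t)
        + ((A' t - A t) * sinPosSq (η t) + (B' t - B t) * sinNegSq (η t))) t := by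
  convert! (hη t).sub (hθ t) using 1
  linear_combination -A t * sinPosSq_sub (θ t) (η t) - B t * sinNegSq_sub (θ t) (η t)

theorem continuous_angle_quot (hA : Continuous A) (hB : Continuous B) (hθ : Continuous θ)
    (hη : Continuous η) : Continuous
      (fun t => A t * sinPosSqQuot (θ t) (η t) + B t * sinNegSqQuot (θ t) (η t)) := by
  have h1 : Continuous fun t => sinPosSqQuot (θ t) (η t) :=
    continuous_sinPosSqQuot.comp (f := fun t => (θ t, η t)) (hθ.prodMk hη)
  have h2 : Continuous fun t => sinNegSqQuot (θ t) (η t) :=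
    continuous_sinNegSqQuot.comp (f := fun t => (θ t, η t)) (hθ.prodMk hη)
  exact (hA.mul h1).add (hB.mul h2)

theorem IsPruferAngle.hasDerivAt_sub_const (hθ : IsPruferAngle c A B θ) (μ t : ℝ) :
    HasDerivAt (fun t => θ t - μ)
      ((A t * sinPosSqQuot μ (θ t) + B t * sinNegSqQuot μ (θ t)) * (θ t - μ)
        + (c t + A t * sinPosSq μ + B t * sinNegSq μ)) t := by
  convert! (hθ t).sub_const μ using 1
  linear_combination -A t * sinPosSq_sub μ (θ t) - B t * sinNegSq_sub μ (θ t)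

theorem sinPosSq_int_mul_pi (j : ℤ) : sinPosSq (j * Real.pi) = 0 := by
  simp [sinPosSq]

theorem sinNegSq_int_mul_pi (j : ℤ) : sinNegSq (j * Real.pi) = 0 := by
  simp [sinNegSq_eq]

/-- Both squared parts of the sine vanish at `j * π`, so the field there is `c > 0`; the deviation
from `j * π` solves a linear equation with forcing `c`. -/
theorem IsPruferAngle.zero_barrier (hA : Continuous A) (hB : Continuous B)
    (hθ : IsPruferAngle c A B θ) (hc : ∀ t, 0 < c t) (j : ℤ) (hs : s₀ ≤ s)
    (h : j * Real.pi ≤ θ s₀) : j * Real.pi ≤ θ s := by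
  have h1 := linear_comparison_nonneg
    (continuous_angle_quot hA hB (continuous_const (y := j * Real.pi)) hθ.continuous)
    (hθ.hasDerivAt_sub_const (j * Real.pi)) hs (fun t _ => by
      simp [sinPosSq_int_mul_pi, sinNegSq_int_mul_pi, (hc t).le])
  by_contra! h3
  have := mul_neg_of_neg_of_pos (sub_neg.2 h3) (Real.exp_pos
    (-∫ r in s₀..s, A r * sinPosSqQuot (j * Real.pi) (θ r)
      + B r * sinNegSqQuot (j * Real.pi) (θ r)))
  linarith

theorem IsPruferAngle.zero_barrier_strict (hA : Continuous A) (hB : Continuous B)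
    (hθ : IsPruferAngle c A B θ) (hc : ∀ t, 0 < c t) (j : ℤ) (hs : s₀ < s)
    (h : j * Real.pi ≤ θ s₀) : j * Real.pi < θ s := by
  have h1 := linear_comparison_pos
    (continuous_angle_quot hA hB (continuous_const (y := j * Real.pi)) hθ.continuous)
    (hθ.hasDerivAt_sub_const (j * Real.pi)) hs (fun t _ => by
      simp [sinPosSq_int_mul_pi, sinNegSq_int_mul_pi, hc t])
  by_contra! h3
  have := mul_nonpos_of_nonpos_of_nonneg (sub_nonpos.2 h3) (Real.exp_pos
    (-∫ r in s₀..s, A r * sinPosSqQuot (j * Real.pi) (θ r)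
      + B r * sinNegSqQuot (j * Real.pi) (θ r))).le
  linarith

theorem sinPosSq_int_mul_pi_add_half (j : ℤ) :
    sinPosSq (j * Real.pi + Real.pi / 2) = if Even j then 1 else 0 := by
  rw [add_comm, sinPosSq_add_int_mul_pi]
  simp [sinPosSq, sinNegSq, Real.sin_add_pi]

theorem sinNegSq_int_mul_pi_add_half (j : ℤ) :
    sinNegSq (j * Real.pi + Real.pi / 2) = if Even j then 0 else 1 := by
  rw [add_comm, sinNegSq_add_int_mul_pi]
  simp [sinPosSq, sinNegSq, Real.sin_add_pi]

/-- At `j * π + π / 2` one squared part is 1 and the other 0, so the field there is `c + parityCoeff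
A B j`. When this is nonpositive the level cannot be passed upwards, nor reached from strictly
below. -/
theorem IsPruferAngle.half_barrier (hA : Continuous A) (hB : Continuous B)
    (hθ : IsPruferAngle c A B θ) (j : ℤ) (hs : s₀ ≤ s)
    (hneg : ∀ t ∈ Ioo s₀ s, c t + parityCoeff A B j t ≤ 0) :
    (θ s₀ ≤ j * Real.pi + Real.pi / 2 → θ s ≤ j * Real.pi + Real.pi / 2) ∧
    (θ s₀ < j * Real.pi + Real.pi / 2 → θ s < j * Real.pi + Real.pi / 2) := by
  set μ := j * Real.pi + Real.pi / 2 with hμ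
  set G := fun t => A t * sinPosSqQuot μ (θ t) + B t * sinNegSqQuot μ (θ t) with hGdef
  have hd : ∀ t, HasDerivAt (fun t => -(θ t - μ))
      (G t * (-(θ t - μ)) + -(c t + parityCoeff A B j t)) t := by
    intro t
    convert! (hθ.hasDerivAt_sub_const μ t).neg using 1
    rw [hμ, sinPosSq_int_mul_pi_add_half, sinNegSq_int_mul_pi_add_half, ← hμ]
    unfold parityCoeff
    split_ifs <;> simp only [hGdef] <;> ring
  have h1 := linear_comparison_nonneg
    (continuous_angle_quot hA hB (continuous_const (y := μ)) hθ.continuous) hd hs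
    (fun t ht => by linarith [hneg t ht])
  have hE := Real.exp_pos (-∫ r in s₀..s, G r)
  constructor
  · intro h
    by_contra! h3
    have := mul_neg_of_neg_of_pos (sub_neg.2 h3) hE
    nlinarith
  · intro h
    by_contra! h3
    have := mul_nonpos_of_nonpos_of_nonneg (sub_nonpos.2 h3) hE.le
    nlinarith

end Barriers

/-! ### Dependence of the angle on the two parameters -/

/-- `θ x` is the Prüfer angle for the parameters `x = (a, b)`, with initial value `x₀` at `T₁`. -/
def IsPruferFamily (c d m n : ℝ → ℝ) (T₁ x₀ : ℝ) (θ : ℝ × ℝ → ℝ → ℝ) : Prop :=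
  ∀ x : ℝ × ℝ, θ x T₁ = x₀ ∧
    IsPruferAngle c (fun t => x.1 * m t - d t) (fun t => x.2 * n t - d t) (θ x)

theorem exists_prufer_family {c d m n : ℝ → ℝ} (hc : Continuous c) (hd : Continuous d)
    (hm : Continuous m) (hn : Continuous n) (T₁ x₀ : ℝ) :
    ∃ θ, IsPruferFamily c d m n T₁ x₀ θ := by
  choose θ hθ using fun x : ℝ × ℝ => exists_prufer_angle (A := fun t => x.1 * m t - d t)
    (B := fun t => x.2 * n t - d t) hc (by fun_prop) (by fun_prop) T₁ x₀
  exact ⟨θ, hθ⟩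

/-- The coefficient of the linear equation for the difference of two Prüfer angles. -/
noncomputable def pruferSlope (d m n : ℝ → ℝ) (θ : ℝ × ℝ → ℝ → ℝ) (x y : ℝ × ℝ) (t : ℝ) : ℝ :=
  (x.1 * m t - d t) * sinPosSqQuot (θ x t) (θ y t)
    + (x.2 * n t - d t) * sinNegSqQuot (θ x t) (θ y t)

/-- The sensitivity of the final angle, with respect to a forcing `w · S θ`. -/
noncomputable def pruferSensitivity (d m n : ℝ → ℝ) (T₁ T₂ : ℝ) (θ : ℝ × ℝ → ℝ → ℝ)
    (w S : ℝ → ℝ) (x y : ℝ × ℝ) : ℝ :=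
  Real.exp (∫ r in T₁..T₂, pruferSlope d m n θ x y r) *
    ∫ t in T₁..T₂, w t * S (θ y t) * Real.exp (-∫ r in T₁..t, pruferSlope d m n θ x y r)

theorem abs_integral_le_of_abs_le {f : ℝ → ℝ} {T R C t : ℝ} (hC : 0 ≤ C)
    (hf : ∀ r ∈ Icc (T - R) (T + R), |f r| ≤ C) (ht : t ∈ Icc (T - R) (T + R)) :
    |∫ r in T..t, f r| ≤ C * R := by
  have hR : |t - T| ≤ R := abs_le.2 ⟨by linarith [ht.1], by linarith [ht.2]⟩
  have h1 := intervalIntegral.norm_integral_le_of_norm_le_const (a := T) (b := t) (C := C) (f := f)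
    (fun r hr => hf r (by
      have := abs_le.1 hR
      rcases le_total T t with h | h
      · rw [uIoc_of_le h] at hr; exact ⟨by linarith [hr.1], by linarith [hr.2]⟩
      · rw [uIoc_of_ge h] at hr; exact ⟨by linarith [hr.1], by linarith [hr.2]⟩))
  exact h1.trans (mul_le_mul_of_nonneg_left hR hC)

namespace IsPruferFamily

variable {c d m n : ℝ → ℝ} {T₁ x₀ : ℝ} {θ : ℝ × ℝ → ℝ → ℝ}

theorem continuous_angle (h : IsPruferFamily c d m n T₁ x₀ θ) (x : ℝ × ℝ) : Continuous (θ x) :=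
  (h x).2.continuous

theorem continuous_slope (h : IsPruferFamily c d m n T₁ x₀ θ) (hd : Continuous d)
    (hm : Continuous m) (hn : Continuous n) (x y : ℝ × ℝ) :
    Continuous (pruferSlope d m n θ x y) :=
  continuous_angle_quot (A := fun t => x.1 * m t - d t) (B := fun t => x.2 * n t - d t)
    (by fun_prop) (by fun_prop) (h.continuous_angle x) (h.continuous_angle y)

/-- Variation of constants for the linear equation of `θ y - θ x`, whose initial value is 0. -/
theorem sub_eq (h : IsPruferFamily c d m n T₁ x₀ θ) (hd : Continuous d)
    (hm : Continuous m) (hn : Continuous n) (x y : ℝ × ℝ) (s : ℝ) :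
    θ y s - θ x s = Real.exp (∫ r in T₁..s, pruferSlope d m n θ x y r) *
      ∫ t in T₁..s, ((y.1 - x.1) * (m t * sinPosSq (θ y t)) +
        (y.2 - x.2) * (n t * sinNegSq (θ y t))) *
          Real.exp (-∫ r in T₁..t, pruferSlope d m n θ x y r) := by
  have hy := h.continuous_angle y
  refine linear_variation_of_constants (e := fun t => θ y t - θ x t)
    (h.continuous_slope hd hm hn x y) ?_ (fun t => ?_) (by simp [(h x).1, (h y).1]) s
  · exact ((hm.mul (continuous_sinPosSq.comp hy)).const_mul _).add
      ((hn.mul (continuous_sinNegSq.comp hy)).const_mul _)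
  · convert! (h x).2.hasDerivAt_sub (h y).2 t using 1
    unfold pruferSlope; ring

/-- The slope involves only the coefficients at `x` and quotients bounded by 2, hence is bounded
independently of `y`. -/
theorem exists_lipschitz_bound (h : IsPruferFamily c d m n T₁ x₀ θ) (hd : Continuous d)
    (hm : Continuous m) (hn : Continuous n) (x : ℝ × ℝ) (R : ℝ) :
    ∃ C, ∀ y, ∀ s ∈ Icc (T₁ - R) (T₁ + R),
      |θ y s - θ x s| ≤ C * (|y.1 - x.1| + |y.2 - x.2|) := by
  obtain ⟨CA, hA0, hCA⟩ := exists_abs_le_on_Icc (f := fun t => x.1 * m t - d t) (by fun_prop)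
    (T₁ - R) (T₁ + R)
  obtain ⟨CB, hB0, hCB⟩ := exists_abs_le_on_Icc (f := fun t => x.2 * n t - d t) (by fun_prop)
    (T₁ - R) (T₁ + R)
  obtain ⟨Cm, hm0, hCm⟩ := exists_abs_le_on_Icc hm (T₁ - R) (T₁ + R)
  obtain ⟨Cn, hn0, hCn⟩ := exists_abs_le_on_Icc hn (T₁ - R) (T₁ + R)
  set K := (CA * 2 + CB * 2) * R with hK
  refine ⟨Real.exp K * ((Cm + Cn) * Real.exp K * R), fun y s hs => ?_⟩
  have hslope : ∀ t ∈ Icc (T₁ - R) (T₁ + R), |pruferSlope d m n θ x y t| ≤ CA * 2 + CB * 2 := by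
    intro t ht
    unfold pruferSlope
    refine (abs_add_le _ _).trans ?_
    rw [abs_mul, abs_mul]
    exact add_le_add
      (mul_le_mul (hCA t ht) (abs_sinPosSqQuot_le _ _) (abs_nonneg _) hA0)
      (mul_le_mul (hCB t ht) (abs_sinNegSqQuot_le _ _) (abs_nonneg _) hB0)
  have hint : ∀ t ∈ Icc (T₁ - R) (T₁ + R), |∫ r in T₁..t, pruferSlope d m n θ x y r| ≤ K :=
    fun t ht => abs_integral_le_of_abs_le (by positivity) hslope ht
  rw [h.sub_eq hd hm hn x y s, abs_mul, Real.abs_exp, mul_assoc]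
  refine mul_le_mul (Real.exp_le_exp.2 ((le_abs_self _).trans (hint s hs))) ?_ (abs_nonneg _)
    (Real.exp_pos _).le
  have hδ : 0 ≤ |y.1 - x.1| + |y.2 - x.2| := by positivity
  refine (abs_integral_le_of_abs_le (R := R)
    (C := (Cm + Cn) * (|y.1 - x.1| + |y.2 - x.2|) * Real.exp K) (by positivity) ?_ hs).trans
    (le_of_eq (by ring))
  intro t ht
  rw [abs_mul, Real.abs_exp]
  refine mul_le_mul ?_ (Real.exp_le_exp.2 ((neg_le_abs _).trans (hint t ht)))
    (Real.exp_pos _).le (by positivity)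
  have e1 : |m t * sinPosSq (θ y t)| ≤ Cm := by
    rw [abs_mul, abs_of_nonneg (sinPosSq_nonneg _)]
    exact (mul_le_of_le_one_right (abs_nonneg _) (sinPosSq_le_one _)).trans (hCm t ht)
  have e2 : |n t * sinNegSq (θ y t)| ≤ Cn := by
    rw [abs_mul, abs_of_nonneg (sinNegSq_nonneg _)]
    exact (mul_le_of_le_one_right (abs_nonneg _) (sinNegSq_le_one _)).trans (hCn t ht)
  refine (abs_add_le _ _).trans ?_
  rw [abs_mul (y.1 - x.1), abs_mul (y.2 - x.2)]
  nlinarith [mul_le_mul_of_nonneg_left e1 (abs_nonneg (y.1 - x.1)),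
    mul_le_mul_of_nonneg_left e2 (abs_nonneg (y.2 - x.2)),
    mul_nonneg hn0 (abs_nonneg (y.1 - x.1)), mul_nonneg hm0 (abs_nonneg (y.2 - x.2))]

theorem continuous_uncurry (h : IsPruferFamily c d m n T₁ x₀ θ) (hd : Continuous d)
    (hm : Continuous m) (hn : Continuous n) :
    Continuous (fun z : (ℝ × ℝ) × ℝ => θ z.1 z.2) := by
  refine continuous_iff_continuousAt.2 fun ⟨x, t⟩ => ?_
  obtain ⟨C, hC⟩ := h.exists_lipschitz_bound hd hm hn x (|t - T₁| + 1)
  have h1 : Filter.Tendsto (fun z : (ℝ × ℝ) × ℝ => θ z.1 z.2 - θ x z.2) (nhds (x, t)) (nhds 0) := by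
    refine squeeze_zero_norm' (a := fun z : (ℝ × ℝ) × ℝ =>
      C * (|z.1.1 - x.1| + |z.1.2 - x.2|)) ?_ ?_
    · have hmem : Ioo (T₁ - (|t - T₁| + 1)) (T₁ + (|t - T₁| + 1)) ∈ nhds t := by
        have := abs_le.1 (le_refl |t - T₁|)
        exact Ioo_mem_nhds (by linarith [this.1]) (by linarith [this.2])
      filter_upwards [continuous_snd.continuousAt.preimage_mem_nhds hmem] with z hz
      exact hC z.1 z.2 (Ioo_subset_Icc_self hz)
    · have : Continuous (fun z : (ℝ × ℝ) × ℝ => C * (|z.1.1 - x.1| + |z.1.2 - x.2|)) := by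
        fun_prop
      simpa using this.tendsto (x, t)
  have h2 : Filter.Tendsto (fun z : (ℝ × ℝ) × ℝ => θ x z.2) (nhds (x, t)) (nhds (θ x t)) :=
    ((h.continuous_angle x).comp continuous_snd).tendsto (x, t)
  simpa [ContinuousAt] using h1.add h2

theorem continuous_slope_uncurry (h : IsPruferFamily c d m n T₁ x₀ θ) (hd : Continuous d)
    (hm : Continuous m) (hn : Continuous n) :
    Continuous (fun z : ((ℝ × ℝ) × (ℝ × ℝ)) × ℝ => pruferSlope d m n θ z.1.1 z.1.2 z.2) := by
  have hθ := h.continuous_uncurry hd hm hn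
  have hx : Continuous fun z : ((ℝ × ℝ) × (ℝ × ℝ)) × ℝ => θ z.1.1 z.2 :=
    hθ.comp (f := fun z : ((ℝ × ℝ) × (ℝ × ℝ)) × ℝ => (z.1.1, z.2)) (by fun_prop)
  have hy : Continuous fun z : ((ℝ × ℝ) × (ℝ × ℝ)) × ℝ => θ z.1.2 z.2 :=
    hθ.comp (f := fun z : ((ℝ × ℝ) × (ℝ × ℝ)) × ℝ => (z.1.2, z.2)) (by fun_prop)
  have h1 := continuous_sinPosSqQuot.comp (hx.prodMk hy)
  have h2 := continuous_sinNegSqQuot.comp (hx.prodMk hy)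
  simp only [Function.comp_def] at h1 h2
  unfold pruferSlope
  fun_prop

theorem continuous_sensitivity (h : IsPruferFamily c d m n T₁ x₀ θ) (hd : Continuous d)
    (hm : Continuous m) (hn : Continuous n) {w S : ℝ → ℝ} (hw : Continuous w) (hS : Continuous S)
    (T₂ : ℝ) : Continuous
      (fun z : (ℝ × ℝ) × (ℝ × ℝ) => pruferSensitivity d m n T₁ T₂ θ w S z.1 z.2) := by
  have hsl := h.continuous_slope_uncurry hd hm hn
  have hθ := h.continuous_uncurry hd hm hn
  have hy : Continuous fun z : ((ℝ × ℝ) × (ℝ × ℝ)) × ℝ => θ z.1.2 z.2 :=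
    hθ.comp (f := fun z : ((ℝ × ℝ) × (ℝ × ℝ)) × ℝ => (z.1.2, z.2)) (by fun_prop)
  have h1 : Continuous fun z : (ℝ × ℝ) × (ℝ × ℝ) =>
      ∫ r in T₁..T₂, pruferSlope d m n θ z.1 z.2 r :=
    intervalIntegral.continuous_parametric_intervalIntegral_of_continuous' hsl _ _
  have h2 : Continuous fun z : ((ℝ × ℝ) × (ℝ × ℝ)) × ℝ =>
      ∫ r in T₁..z.2, pruferSlope d m n θ z.1.1 z.1.2 r := by
    refine intervalIntegral.continuous_parametric_intervalIntegral_of_continuous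
      (f := fun z : ((ℝ × ℝ) × (ℝ × ℝ)) × ℝ => pruferSlope d m n θ z.1.1 z.1.2) ?_ continuous_snd
    exact hsl.comp (f := fun p : (((ℝ × ℝ) × (ℝ × ℝ)) × ℝ) × ℝ => (p.1.1, p.2)) (by fun_prop)
  unfold pruferSensitivity
  refine (Real.continuous_exp.comp h1).mul
    (intervalIntegral.continuous_parametric_intervalIntegral_of_continuous'
      (f := fun z : (ℝ × ℝ) × (ℝ × ℝ) => fun t => w t * S (θ z.2 t) *
        Real.exp (-∫ r in T₁..t, pruferSlope d m n θ z.1 z.2 r)) ?_ _ _)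
  exact ((hw.comp continuous_snd).mul (hS.comp hy)).mul (Real.continuous_exp.comp h2.neg)

/-- An exact first-order expansion with continuous coefficients, which become the partial
derivatives of the final angle at `x = y`. It replaces a theorem on differentiability of flows. -/
theorem sub_eq_sensitivity (h : IsPruferFamily c d m n T₁ x₀ θ) (hd : Continuous d)
    (hm : Continuous m) (hn : Continuous n) (T₂ : ℝ) (x y : ℝ × ℝ) :
    θ y T₂ - θ x T₂ = (y.1 - x.1) * pruferSensitivity d m n T₁ T₂ θ m sinPosSq x y
      + (y.2 - x.2) * pruferSensitivity d m n T₁ T₂ θ n sinNegSq x y := by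
  rw [h.sub_eq hd hm hn x y T₂]
  have hE : Continuous fun t => Real.exp (-∫ r in T₁..t, pruferSlope d m n θ x y r) :=
    continuous_iff_continuousAt.2 fun t =>
      (hasDerivAt_exp_neg_integral (h.continuous_slope hd hm hn x y) T₁ t).continuousAt
  have hy := h.continuous_angle y
  unfold pruferSensitivity
  simp only [add_mul, mul_assoc]
  rw [intervalIntegral.integral_add, intervalIntegral.integral_const_mul,
    intervalIntegral.integral_const_mul]
  · ring
  · exact ((hm.mul ((continuous_sinPosSq.comp hy).mul hE)).const_mul _).intervalIntegrable _ _
  · exact ((hn.mul ((continuous_sinNegSq.comp hy).mul hE)).const_mul _).intervalIntegrable _ _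

end IsPruferFamily

/-! ### Energy identity and positivity of the sensitivities -/

theorem hasDerivWithinAt_max_zero_of_pos {f : ℝ → ℝ} {f' t : ℝ} (hf : HasDerivAt f f' t)
    (h0 : f t = 0) (hpos : 0 < f') : HasDerivWithinAt (fun y => max (f y) 0) f' (Ici t) t := by
  have h1 := (hasDerivWithinAt_iff_tendsto_slope' (self_notMem_Ioi)).1
    (hf.hasDerivWithinAt (s := Ioi t))
  refine (hf.hasDerivWithinAt (s := Ici t)).congr_of_eventuallyEq ?_ (by simp [h0])
  have h2 : ∀ᶠ y in nhdsWithin t (Ioi t), max (f y) 0 = f y := by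
    filter_upwards [h1.eventually (lt_mem_nhds hpos), self_mem_nhdsWithin] with y hy hty
    rw [slope_def_field, h0, sub_zero] at hy
    rw [max_eq_left]
    have := sub_pos.2 (mem_Ioi.1 hty)
    exact ((div_pos_iff_of_pos_right this).1 hy).le
  rw [← Ioi_insert, nhdsWithin_insert]
  exact Filter.eventually_sup.2 ⟨by simp [h0], h2⟩

theorem hasDerivWithinAt_max_zero_of_neg {f : ℝ → ℝ} {f' t : ℝ} (hf : HasDerivAt f f' t)
    (h0 : f t = 0) (hneg : f' < 0) : HasDerivWithinAt (fun y => max (f y) 0) 0 (Ici t) t := by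
  have h1 := hasDerivWithinAt_max_zero_of_pos hf.neg (by simp [h0]) (neg_pos.2 hneg)
  have h2 := (hf.hasDerivWithinAt (s := Ici t)).add h1
  rw [add_neg_cancel] at h2
  refine h2.congr (fun y _ => ?_) (by simp [h0])
  rcases le_total (f y) 0 with h | h
  · simp [h]
  · simp [h]

/-- The energy identity for the positive part of a solution: testing the equation with `u⁺`
bounds `∫ V (u⁺)²` from below by the energy of `u⁺`. -/
theorem IsPruferAngle.integral_pos {c d V B θ : ℝ → ℝ} {T₁ T₂ : ℝ}
    (hθ : IsPruferAngle c (fun t => V t - d t) B θ)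
    (hd : Continuous d) (hV : Continuous V) (hB : Continuous B)
    (hc0 : ∀ t, 0 < c t) (hcd : ∀ t, c t ≤ d t) (h1 : Real.cos (θ T₁) = 0)
    (h2 : Real.cos (θ T₂) = 0) {ts : ℝ} (hts : ts ∈ Ioo T₁ T₂) (hsin : 0 < Real.sin (θ ts))
    (hcos : Real.cos (θ ts) ≠ 0) :
    0 < ∫ t in T₁..T₂, V t * sinPosSq (θ t) * Real.exp (-∫ r in T₁..t,
      ((V r - d r) * sinPosSqDeriv (θ r) + B r * sinPosSqDeriv (θ r + Real.pi))) := by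
  set G := fun r => (V r - d r) * sinPosSqDeriv (θ r) + B r * sinPosSqDeriv (θ r + Real.pi)
    with hG
  set E := fun t => Real.exp (-∫ r in T₁..t, G r) with hE
  -- `E` is the square of the Prüfer radius: `-G` is twice its logarithmic derivative.
  have hθc := hθ.continuous
  have hGc : Continuous G :=
    ((hV.sub hd).mul (continuous_sinPosSqDeriv.comp hθc)).add
      (hB.mul (continuous_sinPosSqDeriv.comp (hθc.add continuous_const)))
  have hEd : ∀ t, HasDerivAt E (-G t * E t) t := hasDerivAt_exp_neg_integral hGc T₁
  have hEpos : ∀ t, 0 < E t := fun t => Real.exp_pos _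
  have hEc : Continuous E := continuous_iff_continuousAt.2 fun t => (hEd t).continuousAt
  have hFc : Continuous fun t => V t * sinPosSq (θ t) * E t :=
    (hV.mul (continuous_sinPosSq.comp hθc)).mul hEc
  have hJ : ∀ t, HasDerivAt (fun t => ∫ r in T₁..t, V r * sinPosSq (θ r) * E r)
      (V t * sinPosSq (θ t) * E t) t := fun t =>
    intervalIntegral.integral_hasDerivAt_right (hFc.intervalIntegrable _ _)
      (hFc.stronglyMeasurableAtFilter _ _) hFc.continuousAt
  -- In terms of u this is P u' u⁺ + ∫ V (u⁺)². Its derivative is P u'² + Q u² where u > 0 and 0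
  -- where u < 0, and its boundary term vanishes at both ends by the Neumann conditions.
  set W := fun t => E t * (max (Real.sin (θ t)) 0 * Real.cos (θ t)) +
    ∫ r in T₁..t, V r * sinPosSq (θ r) * E r with hW
  have hsd : ∀ t, HasDerivAt (fun t => Real.sin (θ t)) (Real.cos (θ t) *
      (c t + (V t - d t) * sinPosSq (θ t) + B t * sinNegSq (θ t))) t :=
    fun t => (hθ t).sin
  have hcd' : ∀ t, HasDerivAt (fun t => Real.cos (θ t)) (-Real.sin (θ t) *
      (c t + (V t - d t) * sinPosSq (θ t) + B t * sinNegSq (θ t))) t :=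
    fun t => (hθ t).cos
  have hpos : ∀ t, 0 < Real.sin (θ t) → HasDerivAt W
      (E t * (c t * Real.cos (θ t) ^ 2 + (d t - c t) * Real.sin (θ t) ^ 2)) t := by
    intro t ht
    have hk : HasDerivAt (fun t => max (Real.sin (θ t)) 0) (Real.cos (θ t) *
        (c t + (V t - d t) * sinPosSq (θ t) + B t * sinNegSq (θ t))) t := by
      refine (hsd t).congr_of_eventuallyEq ?_
      filter_upwards [(Real.continuous_sin.comp hθc).continuousAt.preimage_mem_nhds
        (Ioi_mem_nhds ht)] with y hy
      exact max_eq_left (mem_Ioi.1 hy).le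
    convert! ((hEd t).mul (hk.mul (hcd' t))).add (hJ t) using 1
    have e1 : sinPosSq (θ t) = Real.sin (θ t) ^ 2 := by
      rw [sinPosSq, max_eq_left ht.le]
    have e2 : sinNegSq (θ t) = 0 := by
      rw [sinNegSq_eq, max_eq_right (by linarith)]; simp
    have e3 : G t = (V t - d t) * (2 * Real.sin (θ t) * Real.cos (θ t)) := by
      simp only [hG, sinPosSqDeriv, Real.sin_add_pi]
      rw [max_eq_left ht.le, max_eq_right (by linarith)]; ring
    rw [Pi.mul_apply, e1, e2, e3, max_eq_left ht.le]
    have e4 := Real.sin_sq_add_cos_sq (θ t)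
    linear_combination (E t * (V t - d t - c t + (c t)) * Real.sin (θ t) ^ 2) * e4
  -- At a zero of u the positive part has a corner, so only right derivatives are available;
  -- nonnegative right derivatives suffice for monotonicity.
  have hright : ∀ t, ∃ W', 0 ≤ W' ∧ HasDerivWithinAt W W' (Ici t) t := by
    intro t
    rcases lt_trichotomy (Real.sin (θ t)) 0 with h | h | h
    · refine ⟨0, le_rfl, HasDerivAt.hasDerivWithinAt ?_⟩
      have hk : HasDerivAt (fun t => max (Real.sin (θ t)) 0) 0 t := by
        refine (hasDerivAt_const t (0 : ℝ)).congr_of_eventuallyEq ?_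
        filter_upwards [(Real.continuous_sin.comp hθc).continuousAt.preimage_mem_nhds
          (Iio_mem_nhds h)] with y hy
        exact max_eq_right (mem_Iio.1 hy).le
      convert! ((hEd t).mul (hk.mul (hcd' t))).add (hJ t) using 1
      simp [sinPosSq, max_eq_right h.le]
    · have e1 : sinPosSq (θ t) = 0 := by simp [sinPosSq, h]
      have e2 : sinNegSq (θ t) = 0 := by simp [sinNegSq_eq, h]
      have hs := hsd t
      rw [e1, e2, mul_zero, mul_zero, add_zero, add_zero] at hs
      have e4 := Real.sin_sq_add_cos_sq (θ t)
      rw [h] at e4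
      have hne : Real.cos (θ t) ≠ 0 := fun h => by rw [h] at e4; norm_num at e4
      rcases lt_or_gt_of_ne hne with hn | hp
      · refine ⟨_, ?_, (((hEd t).hasDerivWithinAt).mul
          ((hasDerivWithinAt_max_zero_of_neg hs h (mul_neg_of_neg_of_pos hn (hc0 t))).mul
            (hcd' t).hasDerivWithinAt)).add (hJ t).hasDerivWithinAt⟩
        simp [h, e1]
      · refine ⟨_, ?_, (((hEd t).hasDerivWithinAt).mul
          ((hasDerivWithinAt_max_zero_of_pos hs h (mul_pos hp (hc0 t))).mul
            (hcd' t).hasDerivWithinAt)).add (hJ t).hasDerivWithinAt⟩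
        have := hEpos t
        have := hc0 t
        simp only [Pi.mul_apply, h, e1, max_self]
        have h3 : 0 ≤ E t * (Real.cos (θ t) * c t * Real.cos (θ t)) := by positivity
        linarith
    · refine ⟨_, ?_, (hpos t h).hasDerivWithinAt⟩
      have h3 := hEpos t
      have h4 := hc0 t
      have h5 := sub_nonneg.2 (hcd t)
      positivity
  have hWc : Continuous W :=
    (hEc.mul (((Real.continuous_sin.comp hθc).max continuous_const).mul
      (Real.continuous_cos.comp hθc))).add
      (continuous_iff_continuousAt.2 fun t => (hJ t).continuousAt)
  choose W' hW'0 hW' using hright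
  have hmono : ∀ s t, s ≤ t → W s ≤ W t := by
    intro s t hst
    have := image_le_of_deriv_right_le_deriv_boundary (f := fun t => -W t) (f' := fun t => -W' t)
      (B := fun _ => -W s) (B' := fun _ => 0) (a := s) (b := t) hWc.neg.continuousOn
      (fun x _ => (hW' x).neg) le_rfl continuousOn_const
      (fun x _ => hasDerivWithinAt_const _ _ _) (fun x _ => by simpa using hW'0 x)
      (right_mem_Icc.2 hst)
    linarith
  have hderiv : 0 < E ts * (c ts * Real.cos (θ ts) ^ 2 + (d ts - c ts) * Real.sin (θ ts) ^ 2) := by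
    have h3 := hEpos ts
    have h4 := hc0 ts
    have h5 := sub_nonneg.2 (hcd ts)
    positivity
  -- Otherwise `W` is constant on the interval, against its positive derivative at `ts`.
  have hlt : W T₁ < W T₂ := by
    by_contra! hle
    have hconst : ∀ t ∈ Icc T₁ T₂, W t = W T₁ := fun t ht =>
      le_antisymm ((hmono t T₂ ht.2).trans hle) (hmono T₁ t ht.1)
    have : HasDerivAt W 0 ts := by
      refine (hasDerivAt_const ts (W T₁)).congr_of_eventuallyEq ?_
      filter_upwards [Icc_mem_nhds hts.1 hts.2] with y hy
      exact hconst y hy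
    exact hderiv.ne' ((hpos ts hsin).unique this)
  simpa [hW, h1, h2] using hlt

/-- The first half turn of the angle passes 3π/4 modulo 2π if `i` is even and π/4 if `i` is odd. The
cosine has to be nonzero because Q may vanish, and then only u' ≠ 0 makes the energy positive. -/
theorem IsPruferAngle.exists_sin_pos {c A B θ : ℝ → ℝ} {T₁ T₂ : ℝ} (hT : T₁ < T₂)
    (hθ : IsPruferAngle c A B θ) {i j : ℤ} (hij : i < j)
    (h1 : θ T₁ = i * Real.pi + Real.pi / 2) (h2 : θ T₂ = j * Real.pi + Real.pi / 2) :
    ∃ t ∈ Ioo T₁ T₂, 0 < Real.sin (θ t) ∧ Real.cos (θ t) ≠ 0 := by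
  have hπ := Real.pi_pos
  have hij' : (i : ℝ) + 1 ≤ j := by exact_mod_cast hij
  have hle : (i : ℝ) * Real.pi + Real.pi ≤ j * Real.pi := by nlinarith
  have key : ∀ x, i * Real.pi + Real.pi / 2 < x → x < j * Real.pi + Real.pi / 2 →
      ∃ t ∈ Ioo T₁ T₂, θ t = x := by
    intro x hx1 hx2
    exact intermediate_value_Ioo hT.le hθ.continuous.continuousOn ⟨h1 ▸ hx1, h2 ▸ hx2⟩
  rcases Int.even_or_odd' i with ⟨l, hl | hl⟩
  · obtain ⟨t, ht, hx⟩ := key (i * Real.pi + (Real.pi - Real.pi / 4)) (by linarith) (by linarith)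
    have e : θ t = Real.pi - Real.pi / 4 + l * (2 * Real.pi) := by
      rw [hx, hl]; push_cast; ring
    refine ⟨t, ht, ?_, ?_⟩
    · rw [e, Real.sin_add_int_mul_two_pi, Real.sin_pi_sub, Real.sin_pi_div_four]; positivity
    · rw [e, Real.cos_add_int_mul_two_pi, Real.cos_pi_sub, Real.cos_pi_div_four]
      exact neg_ne_zero.2 (by positivity)
  · obtain ⟨t, ht, hx⟩ := key (i * Real.pi + Real.pi + Real.pi / 4) (by linarith) (by linarith)
    have e : θ t = Real.pi / 4 + (l + 1 : ℤ) * (2 * Real.pi) := by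
      rw [hx, hl]; push_cast; ring
    refine ⟨t, ht, ?_, ?_⟩
    · rw [e, Real.sin_add_int_mul_two_pi, Real.sin_pi_div_four]; positivity
    · rw [e, Real.cos_add_int_mul_two_pi, Real.cos_pi_div_four]; positivity

theorem cos_int_mul_pi_add_half (j : ℤ) : Real.cos (j * Real.pi + Real.pi / 2) = 0 := by
  rw [Real.cos_add_pi_div_two, Real.sin_int_mul_pi, neg_zero]

/-- The symmetry u ↦ −u, which exchanges the two weights. -/
theorem IsPruferAngle.add_pi {c A B θ : ℝ → ℝ} (hθ : IsPruferAngle c A B θ) :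
    IsPruferAngle c B A (fun t => θ t + Real.pi) := by
  intro t
  convert! (hθ t).add_const Real.pi using 1
  have : sinNegSq (θ t + Real.pi) = sinPosSq (θ t) := by
    rw [← sinPosSq_add_two_pi, sinNegSq]; congr 1; ring
  rw [this, sinNegSq]; ring

theorem sinPosSqDeriv_add_two_pi (x : ℝ) :
    sinPosSqDeriv (x + Real.pi + Real.pi) = sinPosSqDeriv x := by
  simp [sinPosSqDeriv, Real.sin_add_pi, Real.cos_add_pi]

section Sensitivity

variable {c d m n : ℝ → ℝ} {T₁ T₂ : ℝ} {i j : ℤ} {θ : ℝ × ℝ → ℝ → ℝ}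

/-- The energy identity with `V = x.1 * m`, divided by `x.1 > 0`. On the diagonal the difference
quotients are derivatives, so the exponential factors of the two statements agree. -/
theorem IsPruferFamily.sensitivity_pos_left
    (h : IsPruferFamily c d m n T₁ (i * Real.pi + Real.pi / 2) θ) (hT : T₁ < T₂)
    (hd : Continuous d) (hm : Continuous m) (hn : Continuous n)
    (hc0 : ∀ t, 0 < c t) (hcd : ∀ t, c t ≤ d t) (hij : i < j) {x : ℝ × ℝ} (hx : 0 < x.1)
    (h2 : θ x T₂ = j * Real.pi + Real.pi / 2) :
    0 < pruferSensitivity d m n T₁ T₂ θ m sinPosSq x x := by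
  obtain ⟨t, ht, hs, hc⟩ := (h x).2.exists_sin_pos hT hij (h x).1 h2
  have := (h x).2.integral_pos (V := fun t => x.1 * m t) (T₂ := T₂) hd (by fun_prop) (by fun_prop)
    hc0 hcd (by rw [(h x).1, cos_int_mul_pi_add_half]) (by rw [h2, cos_int_mul_pi_add_half])
    ht hs hc
  simp only [mul_assoc] at this
  rw [intervalIntegral.integral_const_mul] at this
  unfold pruferSensitivity pruferSlope
  simp only [sinPosSqQuot_self, sinNegSqQuot_self, mul_assoc]
  exact mul_pos (Real.exp_pos _) (pos_of_mul_pos_right this hx.le)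

/-- The same for u⁻, through the shift by π. -/
theorem IsPruferFamily.sensitivity_pos_right
    (h : IsPruferFamily c d m n T₁ (i * Real.pi + Real.pi / 2) θ) (hT : T₁ < T₂)
    (hd : Continuous d) (hm : Continuous m) (hn : Continuous n)
    (hc0 : ∀ t, 0 < c t) (hcd : ∀ t, c t ≤ d t) (hij : i < j) {x : ℝ × ℝ} (hx : 0 < x.2)
    (h2 : θ x T₂ = j * Real.pi + Real.pi / 2) :
    0 < pruferSensitivity d m n T₁ T₂ θ n sinNegSq x x := by
  have h1' : θ x T₁ + Real.pi = ((i + 1 : ℤ) : ℝ) * Real.pi + Real.pi / 2 := by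
    rw [(h x).1]; push_cast; ring
  have h2' : θ x T₂ + Real.pi = ((j + 1 : ℤ) : ℝ) * Real.pi + Real.pi / 2 := by
    rw [h2]; push_cast; ring
  obtain ⟨t, ht, hs, hc⟩ := (h x).2.add_pi.exists_sin_pos hT
    (show i + 1 < j + 1 by lia) h1' h2'
  have := (h x).2.add_pi.integral_pos (V := fun t => x.2 * n t) (T₂ := T₂) hd (by fun_prop)
    (by fun_prop) hc0 hcd (by rw [h1', cos_int_mul_pi_add_half])
    (by rw [h2', cos_int_mul_pi_add_half]) ht hs hc
  simp only [mul_assoc, sinPosSqDeriv_add_two_pi] at this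
  rw [intervalIntegral.integral_const_mul] at this
  unfold pruferSensitivity pruferSlope
  simp only [sinPosSqQuot_self, sinNegSqQuot_self, mul_assoc, sinNegSq]
  simp only [add_comm ((x.1 * m _ - d _) * sinPosSqDeriv (θ x _))]
  exact mul_pos (Real.exp_pos _) (pos_of_mul_pos_right this hx.le)

end Sensitivity

/-! ### Alternating chains are necessary -/

/-- There are `l` points below `s`, the last one in `S j`, the one before in `S (j - 1)`, and
so on. -/
def HasChain (S : ℤ → Set ℝ) : ℕ → ℤ → ℝ → Prop
  | 0, _, _ => True
  | l + 1, j, s => ∃ t < s, t ∈ S j ∧ HasChain S l (j - 1) t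

/-- The points to the right of `T₁` where the weight of the angles in `[jπ, (j+1)π]` is
positive. -/
def positiveSet (m n : ℝ → ℝ) (T₁ : ℝ) (j : ℤ) : Set ℝ := {t | T₁ < t ∧ 0 < parityCoeff m n j t}

section ChainOfAngle

variable {c d V W θ : ℝ → ℝ} {T₁ : ℝ} {j₀ : ℤ}

/-- Contrapositive of the half barrier: `c ≤ d` makes `c + (V - d)` nonpositive wherever `V` is. -/
theorem IsPruferAngle.exists_parityCoeff_pos {s₀ s : ℝ}
    (hθ : IsPruferAngle c (fun t => V t - d t) (fun t => W t - d t) θ)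
    (hd : Continuous d) (hV : Continuous V) (hW : Continuous W) (hcd : ∀ t, c t ≤ d t)
    (j : ℤ) (hs : s₀ ≤ s)
    (h : (θ s₀ ≤ j * Real.pi + Real.pi / 2 ∧ j * Real.pi + Real.pi / 2 < θ s) ∨
      (θ s₀ < j * Real.pi + Real.pi / 2 ∧ j * Real.pi + Real.pi / 2 ≤ θ s)) :
    ∃ t ∈ Ioo s₀ s, 0 < parityCoeff V W j t := by
  by_contra! hneg
  have hb := hθ.half_barrier (by fun_prop) (by fun_prop) j hs (fun t ht => by
    have h1 := hneg t ht
    have h2 := hcd t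
    unfold parityCoeff at h1 ⊢
    split_ifs at h1 ⊢ <;> linarith)
  rcases h with h | h
  · exact (hb.1 h.1).not_gt h.2
  · exact (hb.2 h.1).not_ge h.2

/-- Downward induction on the levels. After its passage through `j * π` the angle can reach `j * π +
π / 2` only with the help of a point `t` where the weight is positive; at `t` it already exceeds the
level below. The lowest level is the initial value and so must be exceeded strictly, while the
higher ones need only be reached. -/
theorem IsPruferAngle.hasChain
    (hθ : IsPruferAngle c (fun t => V t - d t) (fun t => W t - d t) θ)
    (hd : Continuous d) (hV : Continuous V) (hW : Continuous W) (hc : ∀ t, 0 < c t)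
    (hcd : ∀ t, c t ≤ d t) (h1 : θ T₁ = j₀ * Real.pi + Real.pi / 2) (k : ℕ) :
    ∀ (j : ℤ) (s : ℝ), j = j₀ + k → T₁ ≤ s →
      (j * Real.pi + Real.pi / 2 < θ s ∨ (1 ≤ k ∧ j * Real.pi + Real.pi / 2 ≤ θ s)) →
      HasChain (positiveSet V W T₁) (k + 1) j s := by
  have hπ := Real.pi_pos
  induction k with
  | zero =>
    intro j s hj hs h
    have hj0 : j = j₀ := by simpa using hj
    have h : j * Real.pi + Real.pi / 2 < θ s := by
      rcases h with h | h
      · exact h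
      · exact absurd h.1 (by norm_num)
    obtain ⟨t, ht, hpos⟩ := hθ.exists_parityCoeff_pos hd hV hW hcd j hs
      (Or.inl ⟨by rw [h1, hj0], h⟩)
    exact ⟨t, ht.2, ⟨ht.1, hpos⟩, trivial⟩
  | succ k ih =>
    intro j s hj hs h
    have hle : j * Real.pi + Real.pi / 2 ≤ θ s := h.elim le_of_lt And.right
    have hj0 : (j₀ : ℝ) * Real.pi + Real.pi ≤ j * Real.pi := by
      have : (j₀ : ℝ) + 1 ≤ j := by rw [hj]; push_cast; linarith [Nat.cast_nonneg (α := ℝ) k]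
      nlinarith
    obtain ⟨s₀, hs₀, hv⟩ := intermediate_value_Icc hs hθ.continuous.continuousOn
      (show j * Real.pi ∈ Icc (θ T₁) (θ s) from ⟨by rw [h1]; linarith, by linarith⟩)
    obtain ⟨t, ht, hpos⟩ := hθ.exists_parityCoeff_pos hd hV hW hcd j hs₀.2
      (Or.inr ⟨by rw [hv]; linarith, hle⟩)
    have hb := hθ.zero_barrier (hV.sub hd) (hW.sub hd) hc j ht.1.le hv.ge
    refine ⟨t, ht.2, ⟨hs₀.1.trans_lt ht.1, hpos⟩,
      ih (j - 1) t (by push_cast at hj; lia) (hs₀.1.trans ht.1.le) (Or.inl ?_)⟩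
    push_cast
    linarith

end ChainOfAngle

/-! ### Alternating chains are sufficient for large parameters -/

section AngleOfChain

/-- This integral is the time of a half turn at speed c₀ cos² + K sin². Dominated convergence
applies, as the integrand tends to 0 wherever the sine is nonzero. -/
theorem tendsto_integral_inv_cos_sq_add_mul_sin_sq {c₀ : ℝ} (hc₀ : 0 < c₀) :
    Filter.Tendsto (fun K : ℝ => ∫ x in (0 : ℝ)..Real.pi,
      (c₀ * Real.cos x ^ 2 + K * Real.sin x ^ 2)⁻¹) Filter.atTop (nhds 0) := by
  have h := intervalIntegral.tendsto_integral_filter_of_dominated_convergence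
    (μ := MeasureTheory.volume) (a := 0) (b := Real.pi) (l := Filter.atTop)
    (F := fun (K : ℝ) x => (c₀ * Real.cos x ^ 2 + K * Real.sin x ^ 2)⁻¹) (f := fun _ => 0)
    (fun _ => (min c₀ 1)⁻¹) ?_ ?_ ?_ ?_
  · simpa using h
  · refine Filter.Eventually.of_forall fun K => ?_
    exact Measurable.aestronglyMeasurable (by fun_prop)
  · filter_upwards [Filter.eventually_ge_atTop (1 : ℝ)] with K hK
    refine Filter.Eventually.of_forall fun x _ => ?_
    have h1 := Real.sin_sq_add_cos_sq x
    have h2 : min c₀ 1 ≤ c₀ * Real.cos x ^ 2 + K * Real.sin x ^ 2 := by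
      nlinarith [min_le_left c₀ 1, min_le_right c₀ 1, sq_nonneg (Real.sin x),
        sq_nonneg (Real.cos x), mul_nonneg (sub_nonneg.2 (min_le_left c₀ 1)) (sq_nonneg (Real.cos x)),
        mul_nonneg (sub_nonneg.2 ((min_le_right c₀ 1).trans hK)) (sq_nonneg (Real.sin x))]
    have h3 : 0 < min c₀ 1 := lt_min hc₀ one_pos
    rw [Real.norm_eq_abs, abs_of_pos (inv_pos.2 (h3.trans_le h2))]
    exact inv_anti₀ h3 h2
  · exact intervalIntegrable_const
  · have hne : ∀ᵐ x ∂(MeasureTheory.volume : MeasureTheory.Measure ℝ), x ≠ Real.pi :=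
      MeasureTheory.Measure.ae_ne _ _
    filter_upwards [hne] with x hx hmem
    rw [uIoc_of_le Real.pi_pos.le] at hmem
    have hs : 0 < Real.sin x := Real.sin_pos_of_pos_of_lt_pi hmem.1 (lt_of_le_of_ne hmem.2 hx)
    refine Filter.Tendsto.inv_tendsto_atTop ?_
    exact Filter.tendsto_atTop_add_const_left _ _
      (Filter.tendsto_id.atTop_mul_const (by positivity))

/-- Within the half turn the speed is c cos² + (c + weight) sin² ≥ c₀ cos² + K sin². Measured by the
time map ∫ `g`, the angle advances at least as fast as time, and by periodicity a half turn has
length `hI`'s integral. -/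
theorem IsPruferAngle.pass_region {c A B θ : ℝ → ℝ} {s t c₀ K : ℝ} {j : ℤ}
    (hθ : IsPruferAngle c A B θ) (hA : Continuous A) (hB : Continuous B) (hc : ∀ t, 0 < c t)
    (hst : s ≤ t) (hc₀ : 0 < c₀) (hK : 0 < K) (hcge : ∀ r ∈ Icc s t, c₀ ≤ c r)
    (hKge : ∀ r ∈ Icc s t, K ≤ c r + parityCoeff A B j r) (hs : j * Real.pi ≤ θ s)
    (hI : ∫ x in (0 : ℝ)..Real.pi, (c₀ * Real.cos x ^ 2 + K * Real.sin x ^ 2)⁻¹ < t - s) :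
    ((j + 1 : ℤ) : ℝ) * Real.pi ≤ θ t := by
  by_contra! hlt
  set g := fun x => (c₀ * Real.cos x ^ 2 + K * Real.sin x ^ 2)⁻¹ with hg
  have hden : ∀ x, 0 < c₀ * Real.cos x ^ 2 + K * Real.sin x ^ 2 := by
    intro x
    have h1 := Real.sin_sq_add_cos_sq x
    by_cases h : Real.sin x = 0
    · rw [h] at h1 ⊢
      have : Real.cos x ^ 2 = 1 := by linarith
      rw [this]; linarith
    · positivity
  have hgc : Continuous g := Continuous.inv₀ (by fun_prop) fun x => (hden x).ne'
  have hreg : ∀ r ∈ Icc s t, j * Real.pi ≤ θ r ∧ θ r < ((j + 1 : ℤ) : ℝ) * Real.pi := by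
    intro r hr
    refine ⟨hθ.zero_barrier hA hB hc j hr.1 hs, ?_⟩
    by_contra! h
    exact (hθ.zero_barrier hA hB hc (j + 1) hr.2 h).not_gt hlt
  have hder : ∀ r, HasDerivAt (fun r => (∫ x in (j * Real.pi)..θ r, g x) - r)
      (g (θ r) * (c r + A r * sinPosSq (θ r) + B r * sinNegSq (θ r)) - 1) r := by
    intro r
    have h1 : HasDerivAt (fun y => ∫ x in (j * Real.pi)..y, g x) (g (θ r)) (θ r) :=
      intervalIntegral.integral_hasDerivAt_right (hgc.intervalIntegrable _ _)
        (hgc.stronglyMeasurableAtFilter _ _) hgc.continuousAt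
    exact (h1.comp r (hθ r)).sub (hasDerivAt_id r)
  have hmono : MonotoneOn (fun r => (∫ x in (j * Real.pi)..θ r, g x) - r) (Icc s t) := by
    refine monotoneOn_of_deriv_nonneg (convex_Icc _ _)
      (fun r _ => (hder r).continuousAt.continuousWithinAt)
      (fun r _ => (hder r).differentiableAt.differentiableWithinAt) fun r hr => ?_
    rw [interior_Icc] at hr
    have hr := Ioo_subset_Icc_self hr
    rw [(hder r).deriv, sub_nonneg, hg]
    simp only
    rw [inv_mul_eq_div, one_le_div (hden _)]
    obtain ⟨hr1, hr2⟩ := hreg r hr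
    have hx1 : 0 ≤ Real.sin (θ r - j * Real.pi) :=
      Real.sin_nonneg_of_nonneg_of_le_pi (by linarith) (by push_cast at hr2; linarith)
    have e1 : sinPosSq (θ r - j * Real.pi) = Real.sin (θ r - j * Real.pi) ^ 2 := by
      rw [sinPosSq, max_eq_left hx1]
    have e2 : sinNegSq (θ r - j * Real.pi) = 0 := by
      rw [sinNegSq_eq, max_eq_right (by linarith)]; simp
    have e3 := sinPosSq_add_int_mul_pi (θ r - j * Real.pi) j
    have e4 := sinNegSq_add_int_mul_pi (θ r - j * Real.pi) j
    rw [sub_add_cancel, e1, e2] at e3 e4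
    have e5 : Real.sin (θ r - j * Real.pi) ^ 2 = Real.sin (θ r) ^ 2 := by
      rw [Real.sin_sub_int_mul_pi]
      rcases Int.even_or_odd j with h | h <;> simp [h.neg_one_zpow]
    have h1 : c r + A r * sinPosSq (θ r) + B r * sinNegSq (θ r)
        = c r + parityCoeff A B j r * Real.sin (θ r) ^ 2 := by
      rw [e3, e4, e5]; unfold parityCoeff; split_ifs <;> ring
    rw [h1]
    have h2 := Real.sin_sq_add_cos_sq (θ r)
    have h3 : c r = c r * (Real.sin (θ r) ^ 2 + Real.cos (θ r) ^ 2) := by rw [h2, mul_one]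
    linarith [mul_nonneg (sub_nonneg.2 (hcge r hr)) (sq_nonneg (Real.cos (θ r))),
      mul_nonneg (sub_nonneg.2 (hKge r hr)) (sq_nonneg (Real.sin (θ r)))]
  have h1 := hmono (left_mem_Icc.2 hst) (right_mem_Icc.2 hst) hst
  simp only at h1
  have h2 : (∫ x in (j * Real.pi)..θ t, g x) - ∫ x in (j * Real.pi)..θ s, g x
      ≤ ∫ x in (j * Real.pi)..(j * Real.pi + Real.pi), g x := by
    have h3 : 0 ≤ ∫ x in (j * Real.pi)..θ s, g x :=
      intervalIntegral.integral_nonneg hs fun x _ => (inv_pos.2 (hden x)).le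
    have h4 : 0 ≤ ∫ x in θ t..(j * Real.pi + Real.pi), g x :=
      intervalIntegral.integral_nonneg (by push_cast at hlt; linarith)
        fun x _ => (inv_pos.2 (hden x)).le
    have h5 := intervalIntegral.integral_add_adjacent_intervals
      (hgc.intervalIntegrable (j * Real.pi) (θ t) (μ := MeasureTheory.volume))
      (hgc.intervalIntegrable (θ t) (j * Real.pi + Real.pi))
    linarith
  have hper : Function.Periodic g Real.pi := fun x => by
    simp [hg, Real.sin_add_pi, Real.cos_add_pi]
  have h6 := hper.intervalIntegral_add_eq (j * Real.pi) 0
  rw [zero_add] at h6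
  rw [h6] at h2
  linarith

/-- Each chain point has a short interval to its right where the weight exceeds half its value
there; for large `a` the angle makes a half turn in it. The empty chain corresponds to the multiple
of π just below the initial angle. -/
theorem IsPruferFamily.eventually_ge_of_hasChain {c d m n : ℝ → ℝ} {T₁ : ℝ} {j₀ : ℤ}
    {θ : ℝ × ℝ → ℝ → ℝ} (h : IsPruferFamily c d m n T₁ (j₀ * Real.pi + Real.pi / 2) θ)
    (hcc : Continuous c) (hd : Continuous d) (hm : Continuous m) (hn : Continuous n)
    (hc : ∀ t, 0 < c t) (l : ℕ) :
    ∀ (j : ℤ) (s : ℝ), j + 1 = j₀ + l → T₁ ≤ s → HasChain (positiveSet m n T₁) l j s →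
      ∀ᶠ a in Filter.atTop, ((j + 1 : ℤ) : ℝ) * Real.pi ≤ θ (a, a) s := by
  have hπ := Real.pi_pos
  have hA : ∀ x : ℝ × ℝ, Continuous fun t => x.1 * m t - d t := fun x => by fun_prop
  have hB : ∀ x : ℝ × ℝ, Continuous fun t => x.2 * n t - d t := fun x => by fun_prop
  induction l with
  | zero =>
    intro j s hj hs _
    refine Filter.Eventually.of_forall fun a => ?_
    refine (h (a, a)).2.zero_barrier (hA (a, a)) (hB (a, a)) hc _ hs ?_
    rw [(h _).1, hj]
    push_cast
    linarith
  | succ l ih =>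
    rintro j s hj hs ⟨t, hts, ⟨hT, hpos⟩, hch⟩
    have hV : Continuous (parityCoeff m n j) := by unfold parityCoeff; split_ifs <;> assumption
    obtain ⟨δ, hδ, hball⟩ := Metric.eventually_nhds_iff.1
      (hV.continuousAt.eventually (lt_mem_nhds (half_lt_self hpos)))
    set t' := min s (t + δ / 2) with ht'
    have htt' : t < t' := lt_min hts (by linarith)
    have hVge : ∀ r ∈ Icc t t', parityCoeff m n j t / 2 ≤ parityCoeff m n j r := by
      intro r hr
      refine (hball ?_).le
      rw [Real.dist_eq, abs_of_nonneg (by linarith [hr.1])]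
      linarith [hr.2.trans (min_le_right _ _)]
    obtain ⟨r₀, _, hr₀⟩ := (isCompact_Icc (a := t) (b := t')).exists_isMinOn
      (nonempty_Icc.2 htt'.le) hcc.continuousOn
    obtain ⟨D, hD0, hD⟩ := exists_abs_le_on_Icc hd t t'
    have hKt : Filter.Tendsto (fun a : ℝ => a * (parityCoeff m n j t / 2) - D) Filter.atTop
        Filter.atTop :=
      Filter.tendsto_atTop_add_const_right _ _
        (Filter.tendsto_id.atTop_mul_const (half_pos hpos))
    have hI := ((tendsto_integral_inv_cos_sq_add_mul_sin_sq (hc r₀)).comp hKt).eventually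
      (gt_mem_nhds (sub_pos.2 htt'))
    filter_upwards [ih (j - 1) t (by push_cast at hj; lia) hT.le hch, hI,
      hKt.eventually_gt_atTop 0, Filter.eventually_ge_atTop (0 : ℝ)] with a h1 h2 h3 h4
    rw [sub_add_cancel] at h1
    refine (h (a, a)).2.zero_barrier (hA (a, a)) (hB (a, a)) hc _ (min_le_left s (t + δ / 2)) ?_
    refine (h (a, a)).2.pass_region (hA (a, a)) (hB (a, a)) hc htt'.le (hc r₀) h3
      (fun r hr => hr₀ hr) (fun r hr => ?_) h1 h2
    have h5 := (abs_le.1 (hD r hr)).2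
    have h6 := mul_le_mul_of_nonneg_left (hVge r hr) h4
    have h7 := hc r
    have h8 : parityCoeff (fun t => a * m t - d t) (fun t => a * n t - d t) j r
        = a * parityCoeff m n j r - d r := by unfold parityCoeff; split_ifs <;> rfl
    simp only [h8]
    linarith

end AngleOfChain

/-! ### From angles to solutions: zeros, radius and uniqueness -/

theorem sin_int_mul_pi_add_half (j : ℤ) : Real.sin (j * Real.pi + Real.pi / 2) = (-1) ^ j := by
  rw [Real.sin_add_pi_div_two, Real.cos_int_mul_pi]

theorem exists_eq_int_mul_pi_add_half {x : ℝ} (h : Real.cos x = 0) :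
    ∃ l : ℤ, x = l * Real.pi + Real.pi / 2 := by
  obtain ⟨l, hl⟩ := Real.cos_eq_zero_iff.1 h
  exact ⟨l, by rw [hl]; ring⟩

/-- Each multiple of π is passed exactly once, so the zeros of the sine correspond to the integers
in `Ioc i j`. -/
theorem IsPruferAngle.encard_zeros {c A B θ : ℝ → ℝ} {T₁ T₂ : ℝ} {i j : ℤ} (hT : T₁ < T₂)
    (hθ : IsPruferAngle c A B θ) (hA : Continuous A) (hB : Continuous B) (hc : ∀ t, 0 < c t)
    (h1 : θ T₁ = i * Real.pi + Real.pi / 2) (h2 : θ T₂ = j * Real.pi + Real.pi / 2) :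
    i ≤ j ∧ {t ∈ Ioo T₁ T₂ | Real.sin (θ t) = 0}.encard = ((j - i).toNat : ℕ) := by
  have hπ := Real.pi_pos
  have hlt : ∀ {a b : ℤ}, (a : ℝ) * Real.pi < b * Real.pi + Real.pi / 2 → a ≤ b := by
    intro a b h
    by_contra! hab
    have : (b : ℝ) + 1 ≤ a := by exact_mod_cast hab
    nlinarith
  have hgt : ∀ {a b : ℤ}, (a : ℝ) * Real.pi + Real.pi / 2 < b * Real.pi → a < b := by
    intro a b h
    by_contra! hab
    have : (b : ℝ) ≤ a := by exact_mod_cast hab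
    nlinarith
  refine ⟨hlt (h2 ▸ hθ.zero_barrier_strict hA hB hc i hT (by rw [h1]; linarith)), ?_⟩
  have hinj : InjOn θ {t ∈ Ioo T₁ T₂ | Real.sin (θ t) = 0} := by
    have aux : ∀ s t, s < t → Real.sin (θ s) = 0 → θ s ≠ θ t := by
      intro s t hst h0 heq
      obtain ⟨l, hl⟩ := Real.sin_eq_zero_iff.1 h0
      have := hθ.zero_barrier_strict hA hB hc l hst hl.le
      rw [hl, heq] at this
      exact this.false
    rintro s ⟨_, hs⟩ t ⟨_, ht⟩ heq
    rcases lt_trichotomy s t with h | h | h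
    · exact absurd heq (aux s t h hs)
    · exact h
    · exact absurd heq.symm (aux t s h ht)
  have himg : θ '' {t ∈ Ioo T₁ T₂ | Real.sin (θ t) = 0} =
      (fun l : ℤ => (l : ℝ) * Real.pi) '' (Finset.Ioc i j : Set ℤ) := by
    ext x
    constructor
    · rintro ⟨t, ⟨ht, h0⟩, rfl⟩
      obtain ⟨l, hl⟩ := Real.sin_eq_zero_iff.1 h0
      refine ⟨l, ?_, hl⟩
      rw [Finset.coe_Ioc]
      refine ⟨hgt ?_, hlt (h2 ▸ hθ.zero_barrier_strict hA hB hc l ht.2 hl.le)⟩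
      by_contra! hle
      have := hθ.zero_barrier_strict hA hB hc l ht.1 (by rw [h1]; exact hle)
      exact this.ne hl
    · rintro ⟨l, hl, rfl⟩
      rw [Finset.coe_Ioc] at hl
      have e1 : (i : ℝ) + 1 ≤ l := by exact_mod_cast hl.1
      have e2 : (l : ℝ) ≤ j := by exact_mod_cast hl.2
      obtain ⟨t, ht, hx⟩ := intermediate_value_Ioo hT.le hθ.continuous.continuousOn
        (show (l : ℝ) * Real.pi ∈ Ioo (θ T₁) (θ T₂) from
          ⟨by rw [h1]; nlinarith, by rw [h2]; nlinarith⟩)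
      exact ⟨t, ⟨ht, by rw [hx, Real.sin_int_mul_pi]⟩, hx⟩
  rw [← hinj.encard_image, himg, Function.Injective.encard_image, encard_coe_eq_coe_finsetCard,
    Int.card_Ioc]
  intro a b hab
  exact_mod_cast mul_right_cancel₀ hπ.ne' hab

/-- With the angle given, the radius solves ρ' = ρ φ. Solutions are built from angles and identified
by uniqueness, so no angle has to be extracted from a solution. -/
theorem exists_prufer_radius {P q m n θ : ℝ → ℝ} (hP : Continuous P) (hq : Continuous q)
    (hm : Continuous m) (hn : Continuous n) (hP0 : ∀ t, 0 < P t) (a b : ℝ)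
    (hθ : IsPruferAngle (fun t => (P t)⁻¹) (fun t => a * m t - ((P t)⁻¹ + q t))
      (fun t => b * n t - ((P t)⁻¹ + q t)) θ) (T₁ : ℝ) :
    ∃ ρ : ℝ → ℝ, ρ T₁ = 1 ∧ (∀ t, 0 < ρ t) ∧
      (∀ t, HasDerivAt (fun t => ρ t * Real.sin (θ t)) ((P t)⁻¹ * (ρ t * Real.cos (θ t))) t) ∧
      (∀ t, HasDerivAt (fun t => ρ t * Real.cos (θ t))
        (q t * (ρ t * Real.sin (θ t)) - (a * m t * max (ρ t * Real.sin (θ t)) 0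
          - b * n t * max (-(ρ t * Real.sin (θ t))) 0)) t) := by
  have hθc := hθ.continuous
  have hPi : Continuous fun t => (P t)⁻¹ := hP.inv₀ fun t => (hP0 t).ne'
  set φ := fun t => ((P t)⁻¹ + q t) * (Real.sin (θ t) * Real.cos (θ t))
    - a * m t * (max (Real.sin (θ t)) 0 * Real.cos (θ t))
    + b * n t * (max (-Real.sin (θ t)) 0 * Real.cos (θ t)) with hφ
  have hφc : Continuous φ := by fun_prop
  set ρ := fun t => Real.exp (∫ r in T₁..t, φ r) with hρ
  have hρd : ∀ t, HasDerivAt ρ (ρ t * φ t) t := fun t =>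
    (intervalIntegral.integral_hasDerivAt_right (hφc.intervalIntegrable _ _)
      (hφc.stronglyMeasurableAtFilter _ _) hφc.continuousAt).exp
  have hρ0 : ∀ t, 0 < ρ t := fun t => Real.exp_pos _
  have hdec : ∀ x : ℝ, (max x 0 - max (-x) 0 = x) ∧ max x 0 * max (-x) 0 = 0 := by
    intro x
    rcases le_total x 0 with h | h
    · rw [max_eq_right h, max_eq_left (by linarith)]; constructor <;> ring
    · rw [max_eq_left h, max_eq_right (by linarith)]; constructor <;> ring
  refine ⟨ρ, by simp [hρ], hρ0, fun t => ?_, fun t => ?_⟩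
  · convert! (hρd t).mul (hθ t).sin using 1
    obtain ⟨e1, e2⟩ := hdec (Real.sin (θ t))
    rw [sinNegSq_eq, sinPosSq]
    simp only [hφ]
    set x := max (Real.sin (θ t)) 0
    set y := max (-Real.sin (θ t)) 0
    rw [← e1]
    linear_combination ρ t * Real.cos (θ t) * (2 * ((P t)⁻¹ + q t) - a * m t - b * n t) * e2
  · convert! (hρd t).mul (hθ t).cos using 1
    obtain ⟨e1, e2⟩ := hdec (Real.sin (θ t))
    have e3 := Real.sin_sq_add_cos_sq (θ t)
    have e4 : max (ρ t * Real.sin (θ t)) 0 = ρ t * max (Real.sin (θ t)) 0 := by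
      rw [mul_max_of_nonneg _ _ (hρ0 t).le, mul_zero]
    have e5 : max (-(ρ t * Real.sin (θ t))) 0 = ρ t * max (-Real.sin (θ t)) 0 := by
      rw [mul_max_of_nonneg _ _ (hρ0 t).le, mul_zero, mul_neg]
    rw [e4, e5, sinNegSq_eq, sinPosSq]
    simp only [hφ]
    have e6 : Real.cos (θ t) ^ 2 = 1 - Real.sin (θ t) ^ 2 := by linarith
    rcases le_total (Real.sin (θ t)) 0 with h | h
    · rw [max_eq_right h, max_eq_left (by linarith : (0 : ℝ) ≤ -Real.sin (θ t))]
      linear_combination ρ t * ((b * n t) - ((P t)⁻¹ + q t)) * Real.sin (θ t) * e3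
    · rw [max_eq_left h, max_eq_right (by linarith : -Real.sin (θ t) ≤ (0 : ℝ))]
      linear_combination ρ t * ((a * m t) - ((P t)⁻¹ + q t)) * Real.sin (θ t) * e3

theorem abs_max_zero_sub_max_zero_le (x y : ℝ) : |max x 0 - max y 0| ≤ |x - y| := by
  simpa using abs_max_sub_max_le_max x 0 y 0

/-- Uniqueness for the initial value problem of the half-linear system of first order. -/
theorem half_linear_unique {P q m n : ℝ → ℝ} (hP : Continuous P) (hq : Continuous q)
    (hm : Continuous m) (hn : Continuous n) (hP0 : ∀ t, 0 < P t) {a b T₁ T₂ : ℝ}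
    {u₁ v₁ u₂ v₂ : ℝ → ℝ}
    (hu₁ : ∀ t ∈ Icc T₁ T₂, HasDerivWithinAt u₁ ((P t)⁻¹ * v₁ t) (Icc T₁ T₂) t)
    (hv₁ : ∀ t ∈ Icc T₁ T₂, HasDerivWithinAt v₁
      (q t * u₁ t - (a * m t * max (u₁ t) 0 - b * n t * max (-u₁ t) 0)) (Icc T₁ T₂) t)
    (hu₂ : ∀ t ∈ Icc T₁ T₂, HasDerivWithinAt u₂ ((P t)⁻¹ * v₂ t) (Icc T₁ T₂) t)
    (hv₂ : ∀ t ∈ Icc T₁ T₂, HasDerivWithinAt v₂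
      (q t * u₂ t - (a * m t * max (u₂ t) 0 - b * n t * max (-u₂ t) 0)) (Icc T₁ T₂) t)
    (hu : u₁ T₁ = u₂ T₁) (hv : v₁ T₁ = v₂ T₁) :
    ∀ t ∈ Icc T₁ T₂, u₁ t = u₂ t ∧ v₁ t = v₂ t := by
  obtain ⟨Cp, hp0, hCp⟩ := exists_abs_le_on_Icc (f := fun t => (P t)⁻¹) (hP.inv₀ fun t => (hP0 t).ne') T₁ T₂
  obtain ⟨Cq, hq0, hCq⟩ := exists_abs_le_on_Icc hq T₁ T₂
  obtain ⟨Cm, hm0, hCm⟩ := exists_abs_le_on_Icc (hm.const_mul a) T₁ T₂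
  obtain ⟨Cn, hn0, hCn⟩ := exists_abs_le_on_Icc (hn.const_mul b) T₁ T₂
  have key := ODE_solution_unique_of_mem_Icc_right (E := ℝ × ℝ) (a := T₁) (b := T₂)
    (v := fun t x => ((P t)⁻¹ * x.2,
      q t * x.1 - (a * m t * max x.1 0 - b * n t * max (-x.1) 0)))
    (K := NNReal.mk (Cp + Cq + Cm + Cn) (by positivity)) (s := fun _ => univ)
    (f := fun t => (u₁ t, v₁ t)) (g := fun t => (u₂ t, v₂ t))
    ?_ ?_ ?_ (fun _ _ => mem_univ _) ?_ ?_ (fun _ _ => mem_univ _) (by rw [hu, hv])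
  · intro t ht
    exact Prod.ext_iff.1 (key ht)
  · intro t ht
    have ht := Ico_subset_Icc_self ht
    refine LipschitzOnWith.of_dist_le_mul fun x _ y _ => ?_
    rw [NNReal.coe_mk, Prod.dist_eq, Prod.dist_eq, Real.dist_eq, Real.dist_eq, Real.dist_eq,
      Real.dist_eq]
    set D := max |x.1 - y.1| |x.2 - y.2| with hD
    have hD0 : 0 ≤ D := (abs_nonneg _).trans (le_max_left _ _)
    have hD1 : |x.1 - y.1| ≤ D := le_max_left _ _
    have hD2 : |x.2 - y.2| ≤ D := le_max_right _ _
    refine max_le ?_ ?_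
    · rw [← mul_sub, abs_mul]
      have := mul_le_mul (hCp t ht) hD2 (abs_nonneg _) hp0
      nlinarith [mul_nonneg hq0 hD0, mul_nonneg hm0 hD0, mul_nonneg hn0 hD0]
    · have e : q t * x.1 - (a * m t * max x.1 0 - b * n t * max (-x.1) 0) -
          (q t * y.1 - (a * m t * max y.1 0 - b * n t * max (-y.1) 0)) =
          q t * (x.1 - y.1) - a * m t * (max x.1 0 - max y.1 0)
            + b * n t * (max (-x.1) 0 - max (-y.1) 0) := by ring
      rw [e]
      have b1 := mul_le_mul (hCq t ht) hD1 (abs_nonneg _) hq0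
      have b2 := mul_le_mul (hCm t ht) ((abs_max_zero_sub_max_zero_le x.1 y.1).trans hD1)
        (abs_nonneg _) hm0
      have b3 := mul_le_mul (hCn t ht) ((abs_max_zero_sub_max_zero_le (-x.1) (-y.1)).trans
        ((by rw [neg_sub_neg, abs_sub_comm] : |-x.1 - -y.1| = |x.1 - y.1|).le.trans hD1))
        (abs_nonneg _) hn0
      rw [← abs_mul] at b1 b2 b3
      refine (abs_add_le _ _).trans ?_
      have b4 := abs_sub (q t * (x.1 - y.1)) (a * m t * (max x.1 0 - max y.1 0))
      nlinarith [mul_nonneg hp0 hD0]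
  · exact fun t ht => ((hu₁ t ht).continuousWithinAt).prodMk ((hv₁ t ht).continuousWithinAt)
  · intro t ht
    have h := Ico_subset_Icc_self ht
    exact ((hu₁ t h).prodMk (hv₁ t h)).mono_of_mem_nhdsWithin (Icc_mem_nhdsGE_of_mem ht)
  · exact fun t ht => ((hu₂ t ht).continuousWithinAt).prodMk ((hv₂ t ht).continuousWithinAt)
  · intro t ht
    have h := Ico_subset_Icc_self ht
    exact ((hu₂ t h).prodMk (hv₂ t h)).mono_of_mem_nhdsWithin (Icc_mem_nhdsGE_of_mem ht)

section Piece

variable {P q m n u w θ : ℝ → ℝ} {a b T₁ T₂ : ℝ}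

/-- A solution of the Neumann problem is a positive multiple of `ρ sin θ`, if the initial angle
has the right sign. -/
theorem neumannSolution_eq_radius_mul_sin (hP : Continuous P) (hq : Continuous q)
    (hm : Continuous m) (hn : Continuous n) (hP0 : ∀ t, 0 < P t)
    (hθ : IsPruferAngle (fun t => (P t)⁻¹) (fun t => a * m t - ((P t)⁻¹ + q t))
      (fun t => b * n t - ((P t)⁻¹ + q t)) θ) {i : ℤ}
    (h1 : θ T₁ = i * Real.pi + Real.pi / 2)
    (hu : ∀ t ∈ Icc T₁ T₂, HasDerivWithinAt u (w t) (Icc T₁ T₂) t)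
    (hw : ∀ t ∈ Icc T₁ T₂, HasDerivWithinAt (fun x => P x * w x)
      (q t * u t - (a * m t * max (u t) 0 - b * n t * max (-u t) 0)) (Icc T₁ T₂) t)
    (hw1 : w T₁ = 0) (hpos : 0 < u T₁ * Real.sin (θ T₁)) :
    ∃ r : ℝ → ℝ, (∀ t, 0 < r t) ∧ ∀ t ∈ Icc T₁ T₂,
      u t = r t * Real.sin (θ t) ∧ P t * w t = r t * Real.cos (θ t) := by
  obtain ⟨ρ, hρ1, hρ0, hρs, hρc⟩ := exists_prufer_radius hP hq hm hn hP0 a b hθ T₁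
  -- The equation is only positively homogeneous, so the scaling factor has to be positive; it is
  -- ±u(T₁), since the initial sine is ±1.
  set C := u T₁ * Real.sin (θ T₁) with hC
  have hmax : ∀ x, max (C * x) 0 = C * max x 0 := fun x => by
    rw [mul_max_of_nonneg _ _ hpos.le, mul_zero]
  have hs : Real.sin (θ T₁) * Real.sin (θ T₁) = 1 := by
    rw [h1, sin_int_mul_pi_add_half]
    rcases Int.even_or_odd i with h | h <;> simp [h.neg_one_zpow]
  refine ⟨fun t => C * ρ t, fun t => mul_pos hpos (hρ0 t), ?_⟩
  refine half_linear_unique (a := a) (b := b) (v₁ := fun t => P t * w t)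
    (u₂ := fun t => C * ρ t * Real.sin (θ t)) (v₂ := fun t => C * ρ t * Real.cos (θ t))
    hP hq hm hn hP0 ?_ hw ?_ ?_ ?_ ?_
  · intro t ht
    convert! hu t ht using 1
    rw [inv_mul_cancel_left₀ (hP0 t).ne']
  · intro t _
    convert! ((hρs t).const_mul C).hasDerivWithinAt using 1
    · ext t; ring
    · ring
  · intro t _
    convert! ((hρc t).const_mul C).hasDerivWithinAt using 1
    · ext t; ring
    · rw [mul_assoc C, hmax, ← mul_neg C, hmax]; ring
  · simp only [hρ1, mul_one, hC]
    rw [mul_assoc, hs, mul_one]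
  · simp [hw1, h1, cos_int_mul_pi_add_half]

theorem radius_mul_sin_mem_fucikPiece (hT : T₁ < T₂) (hP : Continuous P) (hq : Continuous q)
    (hm : Continuous m) (hn : Continuous n) (hP0 : ∀ t, 0 < P t)
    (hθ : IsPruferAngle (fun t => (P t)⁻¹) (fun t => a * m t - ((P t)⁻¹ + q t))
      (fun t => b * n t - ((P t)⁻¹ + q t)) θ) {j : ℤ} {k : ℕ} {σ : ℤˣ}
    (hσ : ((σ : ℤ) : ℝ) = (-1) ^ j)
    (h1 : θ T₁ = ((j - k : ℤ) : ℝ) * Real.pi + Real.pi / 2)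
    (h2 : θ T₂ = j * Real.pi + Real.pi / 2) :
    (a, b) ∈ fucikPiece T₁ T₂ P q m n k σ := by
  obtain ⟨ρ, -, hρ0, hρs, hρc⟩ := exists_prufer_radius hP hq hm hn hP0 a b hθ T₁
  have hPi : Continuous fun t => (P t)⁻¹ := hP.inv₀ fun t => (hP0 t).ne'
  refine ⟨fun t => ρ t * Real.sin (θ t), ⟨fun t => (P t)⁻¹ * (ρ t * Real.cos (θ t)), fun t _ =>
    (hρs t).hasDerivWithinAt, fun t _ => ?_, ?_, ?_⟩, ?_, ?_⟩
  · convert! (hρc t).hasDerivWithinAt using 1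
    ext x
    rw [mul_inv_cancel_left₀ (hP0 x).ne']
  · simp only [h1, cos_int_mul_pi_add_half, mul_zero]
  · simp [h2, cos_int_mul_pi_add_half]
  · have := (hθ.encard_zeros hT (by fun_prop) (by fun_prop) (fun t => inv_pos.2 (hP0 t)) h1 h2).2
    simpa [(hρ0 _).ne'] using this
  · simp only
    rw [h2, sin_int_mul_pi_add_half, hσ]
    have : (-1 : ℝ) ^ j * (-1) ^ j = 1 := by
      rcases Int.even_or_odd j with h | h <;> simp [h.neg_one_zpow]
    rw [mul_left_comm, this, mul_one]
    exact hρ0 _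

/-- For fixed (a, b) the nontrivial solutions with u'(T₁) = 0 form two rays, distinguished by the
sign of u(T₁). One belongs to `θ`; the other has initial angle larger by π and, with `k` zeros,
would end with the wrong sign. -/
theorem mem_fucikPiece_iff (hT : T₁ < T₂) (hP : Continuous P) (hq : Continuous q)
    (hm : Continuous m) (hn : Continuous n) (hP0 : ∀ t, 0 < P t)
    (hθ : IsPruferAngle (fun t => (P t)⁻¹) (fun t => a * m t - ((P t)⁻¹ + q t))
      (fun t => b * n t - ((P t)⁻¹ + q t)) θ) {j : ℤ} {k : ℕ} {σ : ℤˣ}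
    (hσ : ((σ : ℤ) : ℝ) = (-1) ^ j)
    (h1 : θ T₁ = ((j - k : ℤ) : ℝ) * Real.pi + Real.pi / 2) :
    (a, b) ∈ fucikPiece T₁ T₂ P q m n k σ ↔ θ T₂ = j * Real.pi + Real.pi / 2 := by
  refine ⟨?_, radius_mul_sin_mem_fucikPiece hT hP hq hm hn hP0 hθ hσ h1⟩
  rintro ⟨u, ⟨w, hu, hw, hw1, hw2⟩, hk, hpos⟩
  have hPi : Continuous fun t => (P t)⁻¹ := hP.inv₀ fun t => (hP0 t).ne'
  have hu1 : u T₁ ≠ 0 := by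
    intro h0
    have := half_linear_unique (a := a) (b := b) (u₁ := u) (v₁ := fun t => P t * w t)
      (u₂ := fun _ => 0) (v₂ := fun _ => 0) hP hq hm hn hP0
      (fun t ht => by
        convert! hu t ht using 1
        rw [inv_mul_cancel_left₀ (hP0 t).ne']) hw
      (fun t _ => by simpa using hasDerivWithinAt_const t (Icc T₁ T₂) (0 : ℝ))
      (fun t _ => by simpa using hasDerivWithinAt_const t (Icc T₁ T₂) (0 : ℝ)) h0 (by simp [hw1])
      T₂ (right_mem_Icc.2 hT.le)
    rw [this.1] at hpos
    simp at hpos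
  have key : ∀ (η : ℝ → ℝ) (i : ℤ), IsPruferAngle (fun t => (P t)⁻¹)
      (fun t => a * m t - ((P t)⁻¹ + q t)) (fun t => b * n t - ((P t)⁻¹ + q t)) η →
      η T₁ = i * Real.pi + Real.pi / 2 → 0 < u T₁ * (-1) ^ i →
      η T₂ = ((i + k : ℤ) : ℝ) * Real.pi + Real.pi / 2 ∧ 0 < (-1 : ℝ) ^ j * (-1) ^ (i + k) := by
    intro η i hη hi hsign
    obtain ⟨r, hr0, hr⟩ := neumannSolution_eq_radius_mul_sin hP hq hm hn hP0 hη hi hu hw hw1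
      (by rwa [hi, sin_int_mul_pi_add_half])
    obtain ⟨e1, e2⟩ := hr T₂ (right_mem_Icc.2 hT.le)
    rw [hw2, mul_zero] at e2
    obtain ⟨l, hl⟩ := exists_eq_int_mul_pi_add_half
      ((mul_eq_zero.1 e2.symm).resolve_left (hr0 T₂).ne')
    obtain ⟨hil, hz⟩ := hη.encard_zeros hT (by fun_prop) (by fun_prop)
      (fun t => inv_pos.2 (hP0 t)) hi hl
    have hset : {t ∈ Ioo T₁ T₂ | u t = 0} = {t ∈ Ioo T₁ T₂ | Real.sin (η t) = 0} := by
      ext t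
      refine and_congr_right fun ht => ?_
      rw [(hr t (Ioo_subset_Icc_self ht)).1, mul_eq_zero, or_iff_right (hr0 t).ne']
    rw [hset, hz] at hk
    have hk' : (l - i).toNat = k := by exact_mod_cast hk
    have hl' : l = i + k := by lia
    refine ⟨by rw [hl, hl'], ?_⟩
    rw [e1, hl, sin_int_mul_pi_add_half, hσ, mul_left_comm, hl'] at hpos
    exact pos_of_mul_pos_right hpos (hr0 T₂).le
  by_cases hsign : 0 < u T₁ * (-1) ^ (j - k : ℤ)
  · have := (key θ (j - k) hθ h1 hsign).1
    rwa [sub_add_cancel] at this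
  · exfalso
    have hsign' : 0 < u T₁ * (-1) ^ (j - k + 1 : ℤ) := by
      rw [zpow_add_one₀ (by norm_num)]
      have hne : u T₁ * (-1) ^ (j - k : ℤ) ≠ 0 :=
        mul_ne_zero hu1 (zpow_ne_zero _ (by norm_num))
      have := lt_of_le_of_ne (not_lt.1 hsign) hne
      linarith
    obtain ⟨η, hη1, hη⟩ := exists_prufer_angle (c := fun t => (P t)⁻¹)
      (A := fun t => a * m t - ((P t)⁻¹ + q t)) (B := fun t => b * n t - ((P t)⁻¹ + q t))
      hPi (by fun_prop) (by fun_prop) T₁ (((j - k + 1 : ℤ) : ℝ) * Real.pi + Real.pi / 2)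
    have h3 := (key η (j - k + 1) hη hη1 hsign').2
    have e : (j - k + 1 + k : ℤ) = j + 1 := by ring
    rw [e, zpow_add_one₀ (by norm_num), ← mul_assoc] at h3
    have : (-1 : ℝ) ^ j * (-1) ^ j = 1 := by
      rcases Int.even_or_odd j with h | h <;> simp [h.neg_one_zpow]
    rw [this] at h3
    norm_num at h3

end Piece

/-! ### Level sets that are graphs of decreasing diffeomorphisms -/

/-- A function of two parameters with continuous difference quotients `M` and `N`, that is below
the level `c` on the half-axes and crosses it upwards in both directions at every point of the
open quadrant. -/
structure IsCrossingUpwards (Φ : ℝ × ℝ → ℝ) (M N : ℝ × ℝ → ℝ × ℝ → ℝ) (c : ℝ) : Prop where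
  continuous_left : Continuous fun z : (ℝ × ℝ) × (ℝ × ℝ) => M z.1 z.2
  continuous_right : Continuous fun z : (ℝ × ℝ) × (ℝ × ℝ) => N z.1 z.2
  sub_eq : ∀ x y, Φ y - Φ x = (y.1 - x.1) * M x y + (y.2 - x.2) * N x y
  pos_left : ∀ x, 0 < x.1 → 0 < x.2 → Φ x = c → 0 < M x x
  pos_right : ∀ x, 0 < x.1 → 0 < x.2 → Φ x = c → 0 < N x x
  lt_left : ∀ b, 0 ≤ b → Φ (0, b) < c
  lt_right : ∀ a, 0 ≤ a → Φ (a, 0) < c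

/-- A positive derivative on the level forbids falling below it. Touching it again at `t` would
force smaller values just to the left of `t`. -/
theorem lt_of_deriv_pos_on_level {φ φ' : ℝ → ℝ} {c s t : ℝ} (hφ : ∀ x, HasDerivAt φ (φ' x) x)
    (hpos : ∀ x, s ≤ x → φ x = c → 0 < φ' x) (hst : s < t) (hs : c ≤ φ s) : c < φ t := by
  have h1 : ∀ ⦃x⦄, x ∈ Icc s t → c ≤ φ x :=
    image_le_of_deriv_right_lt_deriv_boundary (f := fun _ => c) (f' := fun _ => 0)
      continuousOn_const (fun x _ => hasDerivWithinAt_const _ _ _) hs hφ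
      (fun x hx he => hpos x hx.1 he.symm)
  refine lt_of_le_of_ne (h1 (right_mem_Icc.2 hst.le)) fun he => ?_
  have h2 := hpos t hst.le he.symm
  have h3 := ((hasDerivWithinAt_iff_tendsto_slope' (self_notMem_Iio)).1
    ((hφ t).hasDerivWithinAt (s := Iio t))).eventually (lt_mem_nhds h2)
  obtain ⟨y, hy1, hy2⟩ := (h3.and (Ioo_mem_nhdsLT hst)).exists
  rw [slope_def_field] at hy1
  have h4 := h1 (Ioo_subset_Icc_self hy2)
  have h5 : (φ y - φ t) / (y - t) ≤ 0 :=
    div_nonpos_of_nonneg_of_nonpos (by linarith) (by linarith [hy2.2])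
  linarith

theorem eq_Ioi_sInf_of_upward_closed {A : Set ℝ} (hne : A.Nonempty) (hpos : ∀ a ∈ A, 0 < a)
    (hup : ∀ a ∈ A, ∀ a', a < a' → a' ∈ A) (hmin : ∀ a ∈ A, ∃ a' ∈ A, a' < a) :
    0 ≤ sInf A ∧ A = Ioi (sInf A) := by
  have hbdd : BddBelow A := ⟨0, fun a ha => (hpos a ha).le⟩
  refine ⟨le_csInf hne fun a ha => (hpos a ha).le, ?_⟩
  ext x
  constructor
  · intro hx
    obtain ⟨a', ha', hlt⟩ := hmin x hx
    exact (csInf_le hbdd ha').trans_lt hlt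
  · intro hx
    obtain ⟨a, ha, hlt⟩ := exists_lt_of_csInf_lt hne hx
    exact hup a ha x hlt

/-- A monotone function whose image is an interval has no jumps. -/
theorem StrictAntiOn.continuousOn_of_image_eq_Ioi {f : ℝ → ℝ} {α β : ℝ}
    (hf : StrictAntiOn f (Ioi α)) (him : f '' Ioi α = Ioi β) : ContinuousOn f (Ioi α) := by
  intro x hx
  have h1 : StrictMonoOn (fun x => -f x) (Ioi α) := fun a ha b hb hab => neg_lt_neg (hf ha hb hab)
  have h2 : (fun x => -f x) '' Ioi α = Iio (-β) := by
    rw [show (fun x => -f x) = (fun y => -y) ∘ f from rfl, image_comp, him]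
    simp
  have h3 : f x ∈ Ioi β := him ▸ mem_image_of_mem f hx
  have h4 := h1.continuousAt_of_image_mem_nhds (Ioi_mem_nhds hx)
    (by rw [h2]; exact Iio_mem_nhds (neg_lt_neg h3))
  have h5 : ContinuousAt (fun y => - -f y) x := h4.neg
  simp only [neg_neg] at h5
  exact h5.continuousWithinAt

namespace IsCrossingUpwards

variable {Φ : ℝ × ℝ → ℝ} {M N : ℝ × ℝ → ℝ × ℝ → ℝ} {c : ℝ}

theorem swap (h : IsCrossingUpwards Φ M N c) : IsCrossingUpwards (fun x => Φ x.swap)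
    (fun x y => N x.swap y.swap) (fun x y => M x.swap y.swap) c where
  continuous_left := h.continuous_right.comp
    (f := fun z : (ℝ × ℝ) × (ℝ × ℝ) => (z.1.swap, z.2.swap)) (by fun_prop)
  continuous_right := h.continuous_left.comp
    (f := fun z : (ℝ × ℝ) × (ℝ × ℝ) => (z.1.swap, z.2.swap)) (by fun_prop)
  sub_eq x y := by rw [h.sub_eq]; simp only [Prod.fst_swap, Prod.snd_swap]; ring
  pos_left x h1 h2 h3 := h.pos_right x.swap h2 h1 h3
  pos_right x h1 h2 h3 := h.pos_left x.swap h2 h1 h3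
  lt_left b hb := h.lt_right b hb
  lt_right a ha := h.lt_left a ha

theorem hasDerivAt_fst (h : IsCrossingUpwards Φ M N c) (a b : ℝ) :
    HasDerivAt (fun x => Φ (x, b)) (M (a, b) (a, b)) a := by
  rw [hasDerivAt_iff_tendsto_slope]
  have h1 : Continuous fun x : ℝ => M (a, b) (x, b) :=
    h.continuous_left.comp (f := fun x : ℝ => ((a, b), (x, b))) (by fun_prop)
  refine ((h1.tendsto a).mono_left nhdsWithin_le_nhds).congr' ?_
  filter_upwards [self_mem_nhdsWithin] with x hx
  have := h.sub_eq (a, b) (x, b)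
  simp only [sub_self, zero_mul, add_zero] at this
  rw [slope_def_field, this, mul_div_cancel_left₀ _ (sub_ne_zero.2 hx)]

theorem lt_of_fst_lt (h : IsCrossingUpwards Φ M N c) {a a' b : ℝ} (ha : 0 < a) (hb : 0 < b)
    (haa' : a < a') (hc : c ≤ Φ (a, b)) : c < Φ (a', b) :=
  lt_of_deriv_pos_on_level (fun x => h.hasDerivAt_fst x b)
    (fun x hx he => h.pos_left (x, b) (ha.trans_le hx) hb he) haa' hc

theorem lt_of_snd_lt (h : IsCrossingUpwards Φ M N c) {a b b' : ℝ} (ha : 0 < a) (hb : 0 < b)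
    (hbb' : b < b') (hc : c ≤ Φ (a, b)) : c < Φ (a, b') :=
  h.swap.lt_of_fst_lt hb ha hbb' hc

theorem exists_fst_lt (h : IsCrossingUpwards Φ M N c) {a b : ℝ} (ha : 0 < a) (hb : 0 < b)
    (hc : c < Φ (a, b)) : ∃ a' ∈ Ioo 0 a, Φ (a', b) = c := by
  have hcont : ContinuousOn (fun x => Φ (x, b)) (Icc 0 a) :=
    fun x _ => (h.hasDerivAt_fst x b).continuousAt.continuousWithinAt
  exact intermediate_value_Ioo ha.le hcont ⟨h.lt_left b hb.le, hc⟩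

theorem exists_snd_lt (h : IsCrossingUpwards Φ M N c) {a b : ℝ} (ha : 0 < a) (hb : 0 < b)
    (hc : c < Φ (a, b)) : ∃ b' ∈ Ioo 0 b, Φ (a, b') = c :=
  h.swap.exists_fst_lt hb ha hc

/-- Along the graph, 0 = (y − a) M + (f y − f a) N with M and N continuous and N > 0 on the
diagonal; dividing gives f' = −M / N. -/
theorem contDiffOn_graph (h : IsCrossingUpwards Φ M N c) {f : ℝ → ℝ} {α : ℝ} (hα : 0 ≤ α)
    (hf : ContinuousOn f (Ioi α)) (hf0 : ∀ a ∈ Ioi α, 0 < f a ∧ Φ (a, f a) = c) :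
    ContDiffOn ℝ 1 f (Ioi α) := by
  have hd : ∀ a ∈ Ioi α,
      HasDerivAt f (-(M (a, f a) (a, f a) / N (a, f a) (a, f a))) a := by
    intro a ha
    have hfa := hf.continuousAt (Ioi_mem_nhds ha)
    rw [hasDerivAt_iff_tendsto_slope]
    have hM : Filter.Tendsto (fun y => M (a, f a) (y, f y)) (nhds a)
        (nhds (M (a, f a) (a, f a))) :=
      (h.continuous_left.tendsto ((a, f a), (a, f a))).comp
        (tendsto_const_nhds.prodMk_nhds (Filter.tendsto_id.prodMk_nhds hfa))
    have hN : Filter.Tendsto (fun y => N (a, f a) (y, f y)) (nhds a)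
        (nhds (N (a, f a) (a, f a))) :=
      (h.continuous_right.tendsto ((a, f a), (a, f a))).comp
        (tendsto_const_nhds.prodMk_nhds (Filter.tendsto_id.prodMk_nhds hfa))
    have hNpos := h.pos_right (a, f a) (hα.trans_lt ha) (hf0 a ha).1 (hf0 a ha).2
    refine (((hM.div hN hNpos.ne').neg).mono_left nhdsWithin_le_nhds).congr' ?_
    filter_upwards [self_mem_nhdsWithin,
      nhdsWithin_le_nhds (hN.eventually (lt_mem_nhds hNpos)),
      nhdsWithin_le_nhds (Ioi_mem_nhds ha)] with y hy hy2 hy3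
    have e := h.sub_eq (a, f a) (y, f y)
    rw [(hf0 a ha).2, (hf0 y hy3).2, sub_self] at e
    have hya : y - a ≠ 0 := sub_ne_zero.2 hy
    have hne := hy2.ne'
    rw [slope_def_field]
    simp only [Pi.div_apply]
    field_simp
    simp only at e
    linarith
  rw [show (1 : WithTop ℕ∞) = 0 + 1 from rfl, contDiffOn_succ_iff_deriv_of_isOpen isOpen_Ioi]
  refine ⟨fun a ha => (hd a ha).differentiableAt.differentiableWithinAt, by simp, ?_⟩
  rw [contDiffOn_zero]
  refine ContinuousOn.congr ?_ fun a ha => (hd a ha).deriv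
  have hp : ContinuousOn (fun a => ((a, f a), (a, f a))) (Ioi α) :=
    (continuousOn_id.prodMk hf).prodMk (continuousOn_id.prodMk hf)
  exact ((h.continuous_left.comp_continuousOn hp).div (h.continuous_right.comp_continuousOn hp)
    fun a ha => (h.pos_right (a, f a) (hα.trans_lt ha) (hf0 a ha).1 (hf0 a ha).2).ne').neg

/-- Raising one coordinate from the level set lifts `Φ` above the level, and lowering the other
returns to it before the axis. Hence both projections are upward closed without minimum, that is,
open half-lines, and the level set is a strictly decreasing graph over each. -/
theorem isHyperbolicLike (h : IsCrossingUpwards Φ M N c) (ε₁ ε₂ : ℤˣ)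
    (hne : {x : ℝ × ℝ | 0 < x.1 ∧ 0 < x.2 ∧ Φ x = c}.Nonempty) :
    IsHyperbolicLike ε₁ ε₂ ((fun x : ℝ × ℝ => (((ε₁ : ℤ) : ℝ) * x.1, ((ε₂ : ℤ) : ℝ) * x.2)) ''
      {x | 0 < x.1 ∧ 0 < x.2 ∧ Φ x = c}) := by
  set A : Set ℝ := {a | 0 < a ∧ ∃ b, 0 < b ∧ Φ (a, b) = c} with hA
  set B : Set ℝ := {b | 0 < b ∧ ∃ a, 0 < a ∧ Φ (a, b) = c} with hB
  have key : ∀ {Φ M N} (_ : IsCrossingUpwards Φ M N c) {x : ℝ × ℝ}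
      (_ : 0 < x.1 ∧ 0 < x.2 ∧ Φ x = c), 0 ≤ sInf {a | 0 < a ∧ ∃ b, 0 < b ∧ Φ (a, b) = c} ∧
      {a | 0 < a ∧ ∃ b, 0 < b ∧ Φ (a, b) = c} =
        Ioi (sInf {a | 0 < a ∧ ∃ b, 0 < b ∧ Φ (a, b) = c}) := by
    intro Φ M N h x hx
    refine eq_Ioi_sInf_of_upward_closed ⟨x.1, hx.1, x.2, hx.2.1, hx.2.2⟩ (fun a ha => ha.1) ?_ ?_
    · rintro a ⟨ha, b, hb, hc⟩ a' haa'
      obtain ⟨b', hb', hc'⟩ := h.exists_snd_lt (ha.trans haa') hb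
        (h.lt_of_fst_lt ha hb haa' hc.ge)
      exact ⟨ha.trans haa', b', hb'.1, hc'⟩
    · rintro a ⟨ha, b, hb, hc⟩
      obtain ⟨a', ha', hc'⟩ := h.exists_fst_lt ha (hb.trans (lt_add_one b))
        (h.lt_of_snd_lt ha hb (lt_add_one b) hc.ge)
      exact ⟨a', ⟨ha'.1, b + 1, by linarith, hc'⟩, ha'.2⟩
  obtain ⟨x, hx⟩ := hne
  obtain ⟨hα, hAα⟩ := key h hx
  obtain ⟨hβ, hBβ⟩ := key h.swap (x := x.swap) ⟨hx.2.1, hx.1, by simpa using hx.2.2⟩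
  simp only [Prod.swap_prod_mk] at hβ hBβ
  rw [← hA] at hα hAα
  rw [← hB] at hβ hBβ
  have hf : ∀ a ∈ Ioi (sInf A), ∃ b, 0 < b ∧ Φ (a, b) = c := fun a ha => by
    rw [← hAα] at ha; exact ha.2
  have hg : ∀ b ∈ Ioi (sInf B), ∃ a, 0 < a ∧ Φ (a, b) = c := fun b hb => by
    rw [← hBβ] at hb; exact hb.2
  choose! f hf0 hfc using hf
  choose! g hg0 hgc using hg
  have hAmem : ∀ {a b}, 0 < a → 0 < b → Φ (a, b) = c → a ∈ Ioi (sInf A) := fun ha hb hc => by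
    rw [← hAα]; exact ⟨ha, _, hb, hc⟩
  have hBmem : ∀ {a b}, 0 < a → 0 < b → Φ (a, b) = c → b ∈ Ioi (sInf B) := fun ha hb hc => by
    rw [← hBβ]; exact ⟨hb, _, ha, hc⟩
  have hA0 : ∀ a ∈ Ioi (sInf A), 0 < a := fun a ha => hα.trans_lt ha
  have hB0 : ∀ b ∈ Ioi (sInf B), 0 < b := fun b hb => hβ.trans_lt hb
  have huniq : ∀ {a b b'}, 0 < a → 0 < b → 0 < b' → Φ (a, b) = c → Φ (a, b') = c → b = b' := by
    intro a b b' ha hb hb' hc hc'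
    rcases lt_trichotomy b b' with hlt | heq | hlt
    · exact absurd hc' (h.lt_of_snd_lt ha hb hlt hc.ge).ne'
    · exact heq
    · exact absurd hc (h.lt_of_snd_lt ha hb' hlt hc'.ge).ne'
  have huniq' : ∀ {a a' b}, 0 < a → 0 < a' → 0 < b → Φ (a, b) = c → Φ (a', b) = c → a = a' := by
    intro a a' b ha ha' hb hc hc'
    rcases lt_trichotomy a a' with hlt | heq | hlt
    · exact absurd hc' (h.lt_of_fst_lt ha hb hlt hc.ge).ne'
    · exact heq
    · exact absurd hc (h.lt_of_fst_lt ha' hb hlt hc'.ge).ne'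
  have hfm : MapsTo f (Ioi (sInf A)) (Ioi (sInf B)) := fun a ha =>
    hBmem (hA0 a ha) (hf0 a ha) (hfc a ha)
  have hgm : MapsTo g (Ioi (sInf B)) (Ioi (sInf A)) := fun b hb =>
    hAmem (hg0 b hb) (hB0 b hb) (hgc b hb)
  have hinv : InvOn g f (Ioi (sInf A)) (Ioi (sInf B)) :=
    ⟨fun a ha => huniq' (hg0 _ (hfm ha)) (hA0 a ha) (hf0 a ha) (hgc _ (hfm ha)) (hfc a ha),
      fun b hb => huniq (hg0 b hb) (hf0 _ (hgm hb)) (hB0 b hb) (hfc _ (hgm hb)) (hgc b hb)⟩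
  have hanti : StrictAntiOn f (Ioi (sInf A)) := by
    intro a ha a' ha' hlt
    by_contra! hle
    have h1 := h.lt_of_fst_lt (hA0 a ha) (hf0 a ha) hlt (hfc a ha).ge
    rcases hle.lt_or_eq with hlt' | heq
    · exact (h.lt_of_snd_lt (hA0 a' ha') (hf0 a ha) hlt' h1.le).ne' (hfc a' ha')
    · rw [heq, hfc a' ha'] at h1; exact h1.false
  have hanti' : StrictAntiOn g (Ioi (sInf B)) := by
    intro b hb b' hb' hlt
    by_contra! hle
    have h1 := hanti.antitoneOn (hgm hb) (hgm hb') hle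
    rw [hinv.2 hb, hinv.2 hb'] at h1
    exact h1.not_gt hlt
  have hfim : f '' Ioi (sInf A) = Ioi (sInf B) :=
    (hfm.image_subset).antisymm fun b hb => ⟨g b, hgm hb, hinv.2 hb⟩
  have hgim : g '' Ioi (sInf B) = Ioi (sInf A) :=
    (hgm.image_subset).antisymm fun a ha => ⟨f a, hfm ha, hinv.1 ha⟩
  refine ⟨sInf A, sInf B, f, g, hα, hβ, hfm, hgm, hinv,
    h.contDiffOn_graph hα (hanti.continuousOn_of_image_eq_Ioi hfim)
      (fun a ha => ⟨hf0 a ha, hfc a ha⟩),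
    h.swap.contDiffOn_graph hβ (hanti'.continuousOn_of_image_eq_Ioi hgim)
      (fun b hb => ⟨hg0 b hb, hgc b hb⟩), hanti, ?_⟩
  ext y
  constructor
  · rintro ⟨z, ⟨h1, h2, h3⟩, rfl⟩
    have hz := hAmem h1 h2 h3
    refine ⟨z.1, hz, ?_⟩
    simp only
    rw [huniq h1 (hf0 _ hz) h2 (hfc _ hz) h3]
  · rintro ⟨a, ha, rfl⟩
    exact ⟨(a, f a), ⟨hA0 a ha, hf0 a ha, hfc a ha⟩, rfl⟩

end IsCrossingUpwards

/-! ### Pieces of the spectrum in a quadrant -/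

/-- The index of the final angle `jπ + π/2` of the solutions that end with the sign `σ`. -/
def signIndex (σ : ℤˣ) : ℤ := if σ = 1 then 0 else -1

theorem coe_sign_eq (σ : ℤˣ) : ((σ : ℤ) : ℝ) = (-1) ^ signIndex σ := by
  rcases Int.units_eq_one_or σ with rfl | rfl <;> simp [signIndex]

theorem IsNeumannSolution.congr {T₁ T₂ a b a' b' : ℝ} {p q m n p' q' m' n' u : ℝ → ℝ}
    (h : IsNeumannSolution T₁ T₂ p q m n a b u) (hp : EqOn p p' (Icc T₁ T₂))
    (hq : EqOn q q' (Icc T₁ T₂)) (hm : ∀ t, a * m t = a' * m' t) (hn : ∀ t, b * n t = b' * n' t) :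
    IsNeumannSolution T₁ T₂ p' q' m' n' a' b' u := by
  obtain ⟨w, h1, h2, h3⟩ := h
  refine ⟨w, h1, fun t ht => ?_, h3⟩
  rw [← hm, ← hn, ← hq ht]
  exact (h2 t ht).congr (fun x hx => by rw [hp hx]) (by rw [hp ht])

/-- Serves to move the signs of a quadrant from the parameters into the weights, and to replace the
coefficients by extensions to the line. -/
theorem mem_fucikPiece_congr {T₁ T₂ a b a' b' : ℝ} {p q m n p' q' m' n' : ℝ → ℝ}
    (hp : EqOn p p' (Icc T₁ T₂)) (hq : EqOn q q' (Icc T₁ T₂)) (hm : ∀ t, a * m t = a' * m' t)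
    (hn : ∀ t, b * n t = b' * n' t) (k : ℕ) (σ : ℤˣ) :
    (a, b) ∈ fucikPiece T₁ T₂ p q m n k σ ↔ (a', b') ∈ fucikPiece T₁ T₂ p' q' m' n' k σ :=
  exists_congr fun _ => and_congr_left fun _ => ⟨fun h => h.congr hp hq hm hn,
    fun h => h.congr hp.symm hq.symm (fun t => (hm t).symm) fun t => (hn t).symm⟩

theorem coe_units_mul_self (ε : ℤˣ) : ((ε : ℤ) : ℝ) * ((ε : ℤ) : ℝ) = 1 := by
  rcases Int.units_eq_one_or ε with rfl | rfl <;> simp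

/-- The structure of one piece of the Fučík spectrum in one quadrant. -/
theorem fucikPiece_inter_quadrant {T₁ T₂ : ℝ} (hT : T₁ < T₂) {P q m n : ℝ → ℝ}
    (hP : Continuous P) (hq : Continuous q) (hm : Continuous m) (hn : Continuous n)
    (hP0 : ∀ t, 0 < P t) (hq0 : ∀ t, 0 ≤ q t) (ε₁ ε₂ : ℤˣ) {k : ℕ} (hk : 1 ≤ k) (σ : ℤˣ) :
    ((fucikPiece T₁ T₂ P q m n k σ ∩ quadrant ε₁ ε₂).Nonempty ↔
      HasChain (positiveSet (fun t => ((ε₁ : ℤ) : ℝ) * m t) (fun t => ((ε₂ : ℤ) : ℝ) * n t) T₁)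
        (k + 1) (signIndex σ) T₂) ∧
    ((fucikPiece T₁ T₂ P q m n k σ ∩ quadrant ε₁ ε₂).Nonempty →
      IsHyperbolicLike ε₁ ε₂ (fucikPiece T₁ T₂ P q m n k σ ∩ quadrant ε₁ ε₂)) := by
  have hπ := Real.pi_pos
  set e₁ : ℝ := ((ε₁ : ℤ) : ℝ) with he₁
  set e₂ : ℝ := ((ε₂ : ℤ) : ℝ) with he₂
  have hee₁ : e₁ * e₁ = 1 := coe_units_mul_self ε₁
  have hee₂ : e₂ * e₂ = 1 := coe_units_mul_self ε₂
  set j := signIndex σ with hj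
  have hPi : Continuous fun t => (P t)⁻¹ := hP.inv₀ fun t => (hP0 t).ne'
  have hc0 : ∀ t, 0 < (P t)⁻¹ := fun t => inv_pos.2 (hP0 t)
  have hcd : ∀ t, (P t)⁻¹ ≤ (P t)⁻¹ + q t := fun t => by linarith [hq0 t]
  have hd : Continuous fun t => (P t)⁻¹ + q t := hPi.add hq
  have hm' : Continuous fun t => e₁ * m t := hm.const_mul _
  have hn' : Continuous fun t => e₂ * n t := hn.const_mul _
  obtain ⟨θ, hθ⟩ := exists_prufer_family hPi hd hm' hn' T₁
    (((j - k : ℤ) : ℝ) * Real.pi + Real.pi / 2)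
  have hmem : ∀ x : ℝ × ℝ, (e₁ * x.1, e₂ * x.2) ∈ fucikPiece T₁ T₂ P q m n k σ ↔
      θ x T₂ = j * Real.pi + Real.pi / 2 := by
    intro x
    rw [← mem_fucikPiece_iff hT hP hq hm' hn' hP0 (hθ x).2 (coe_sign_eq σ) (hθ x).1]
    exact mem_fucikPiece_congr (fun _ _ => rfl) (fun _ _ => rfl) (fun t => by ring)
      (fun t => by ring) k σ
  have hchain : ∀ x : ℝ × ℝ, j * Real.pi + Real.pi / 2 ≤ θ x T₂ →
      HasChain (positiveSet (fun t => x.1 * (e₁ * m t)) (fun t => x.2 * (e₂ * n t)) T₁)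
        (k + 1) j T₂ := fun x hx =>
    (hθ x).2.hasChain (V := fun t => x.1 * (e₁ * m t)) (W := fun t => x.2 * (e₂ * n t)) hd
      (by fun_prop) (by fun_prop) hc0 hcd (hθ x).1 k j T₂ (by ring) hT.le (Or.inr ⟨hk, hx⟩)
  have hmono : ∀ {m n m' n' : ℝ → ℝ}, (∀ t, 0 < m t → 0 < m' t) → (∀ t, 0 < n t → 0 < n' t) →
      ∀ (l : ℕ) (i : ℤ) (s : ℝ), HasChain (positiveSet m n T₁) l i s →
        HasChain (positiveSet m' n' T₁) l i s := by
    intro m n m' n' hmm hnn l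
    induction l with
    | zero => exact fun _ _ _ => trivial
    | succ l ih =>
      rintro i s ⟨t, hts, ⟨ht1, ht2⟩, hch⟩
      refine ⟨t, hts, ⟨ht1, ?_⟩, ih _ _ hch⟩
      unfold parityCoeff at ht2 ⊢
      split_ifs at ht2 ⊢
      · exact hmm t ht2
      · exact hnn t ht2
  -- As `k ≥ 1`, the chain has two consecutive points, hence one for each weight.
  have hboth : ∀ {m n : ℝ → ℝ}, HasChain (positiveSet m n T₁) (k + 1) j T₂ →
      (∃ t, 0 < m t) ∧ ∃ t, 0 < n t := by
    intro m n hch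
    obtain ⟨l, rfl⟩ : ∃ l, k = l + 1 := ⟨k - 1, by lia⟩
    obtain ⟨t, -, ⟨-, ht⟩, t', -, ⟨-, ht'⟩, -⟩ := hch
    unfold parityCoeff at ht ht'
    rcases Int.even_or_odd j with h | h
    · rw [if_pos h] at ht
      rw [if_neg (by simpa using h.sub_odd odd_one)] at ht'
      exact ⟨⟨t, ht⟩, t', ht'⟩
    · rw [if_neg (by simpa using h)] at ht
      rw [if_pos (by simpa using h.sub_odd odd_one)] at ht'
      exact ⟨⟨t', ht'⟩, t, ht⟩
  -- If a parameter is 0, its scaled weight is nowhere positive, so no chain exists and the level is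
  -- not reached. This keeps the curve off the axes.
  have hpos : ∀ x : ℝ × ℝ, 0 ≤ x.1 → 0 ≤ x.2 → j * Real.pi + Real.pi / 2 ≤ θ x T₂ →
      0 < x.1 ∧ 0 < x.2 := by
    intro x h1 h2 hx
    obtain ⟨⟨t, ht⟩, t', ht'⟩ := hboth (hchain x hx)
    exact ⟨lt_of_le_of_ne h1 fun h => by simp [← h] at ht,
      lt_of_le_of_ne h2 fun h => by simp [← h] at ht'⟩
  have hlt : j - (k : ℤ) < j := by lia
  have hcross : IsCrossingUpwards (fun x => θ x T₂)
      (pruferSensitivity (fun t => (P t)⁻¹ + q t) (fun t => e₁ * m t) (fun t => e₂ * n t) T₁ T₂ θ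
        (fun t => e₁ * m t) sinPosSq)
      (pruferSensitivity (fun t => (P t)⁻¹ + q t) (fun t => e₁ * m t) (fun t => e₂ * n t) T₁ T₂ θ
        (fun t => e₂ * n t) sinNegSq) (j * Real.pi + Real.pi / 2) :=
    { continuous_left := hθ.continuous_sensitivity hd hm' hn' hm' continuous_sinPosSq T₂
      continuous_right := hθ.continuous_sensitivity hd hm' hn' hn' continuous_sinNegSq T₂
      sub_eq := fun x y => hθ.sub_eq_sensitivity hd hm' hn' T₂ x y
      pos_left := fun x h1 _ hx => hθ.sensitivity_pos_left hT hd hm' hn' hc0 hcd hlt h1 hx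
      pos_right := fun x _ h2 hx => hθ.sensitivity_pos_right hT hd hm' hn' hc0 hcd hlt h2 hx
      lt_left := fun b hb => by
        by_contra! h
        exact (hpos (0, b) le_rfl hb h).1.false
      lt_right := fun a ha => by
        by_contra! h
        exact (hpos (a, 0) ha le_rfl h).2.false }
  have hset : fucikPiece T₁ T₂ P q m n k σ ∩ quadrant ε₁ ε₂ =
      (fun x : ℝ × ℝ => (e₁ * x.1, e₂ * x.2)) ''
        {x | 0 < x.1 ∧ 0 < x.2 ∧ θ x T₂ = j * Real.pi + Real.pi / 2} := by
    ext ⟨a, b⟩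
    constructor
    · rintro ⟨h1, h2, h3⟩
      have ea : e₁ * (e₁ * a) = a := by rw [← mul_assoc, hee₁, one_mul]
      have eb : e₂ * (e₂ * b) = b := by rw [← mul_assoc, hee₂, one_mul]
      have h4 : θ (e₁ * a, e₂ * b) T₂ = j * Real.pi + Real.pi / 2 := by
        rw [← hmem]
        simp only
        rwa [ea, eb]
      obtain ⟨h5, h6⟩ := hpos (e₁ * a, e₂ * b) h2 h3 h4.ge
      exact ⟨(e₁ * a, e₂ * b), ⟨h5, h6, h4⟩, by simp only [ea, eb]⟩
    · rintro ⟨x, ⟨h1, h2, h3⟩, hx⟩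
      rw [← hx]
      refine ⟨(hmem x).2 h3, ?_, ?_⟩
      · simp only
        rw [← mul_assoc, hee₁, one_mul]; exact h1.le
      · simp only
        rw [← mul_assoc, hee₂, one_mul]; exact h2.le
  rw [hset]
  refine ⟨⟨?_, fun hch => ?_⟩, fun hne => hcross.isHyperbolicLike ε₁ ε₂ hne.of_image⟩
  · rintro ⟨_, x, ⟨h1, h2, h3⟩, -⟩
    exact hmono (fun t ht => pos_of_mul_pos_right ht h1.le)
      (fun t ht => pos_of_mul_pos_right ht h2.le) _ _ _ (hchain x h3.ge)
  · have hev := hθ.eventually_ge_of_hasChain hPi hd hm' hn' hc0 (k + 1) j T₂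
      (by push_cast; ring) hT.le hch
    obtain ⟨a, ha, ha0⟩ := (hev.and (Filter.eventually_gt_atTop 0)).exists
    push_cast at ha
    obtain ⟨b, hb, hb'⟩ := hcross.exists_snd_lt ha0 ha0 (by linarith)
    exact ⟨_, (a, b), ⟨ha0, hb.1, hb'⟩, rfl⟩

/-- The number of the curves in a quadrant is the number of the alternating chains of points at
which the weights have the right signs. -/
theorem hasExactlyCurves_of_encard_chains {T₁ T₂ : ℝ} (hT : T₁ < T₂) {p q m n : ℝ → ℝ}
    (hp : ContinuousOn p (Icc T₁ T₂)) (hq : ContinuousOn q (Icc T₁ T₂))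
    (hp0 : ∀ t ∈ Icc T₁ T₂, 0 < p t) (hq0 : ∀ t ∈ Icc T₁ T₂, 0 ≤ q t)
    (hm : Continuous m) (hn : Continuous n) (ε₁ ε₂ : ℤˣ) {N : ℕ∞}
    (hN : {i : ℕ × ℤˣ | 1 ≤ i.1 ∧ HasChain (positiveSet (fun t => ((ε₁ : ℤ) : ℝ) * m t)
      (fun t => ((ε₂ : ℤ) : ℝ) * n t) T₁) (i.1 + 1) (signIndex i.2) T₂}.encard = N) :
    HasExactlyCurves T₁ T₂ p q m n ε₁ ε₂ N := by
  -- The given coefficients are continuous only on the interval; constant continuation makes them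
  -- global without changing the pieces.
  set P := IccExtend hT.le ((Icc T₁ T₂).domRestrict p) with hP
  set Q := IccExtend hT.le ((Icc T₁ T₂).domRestrict q) with hQ
  have hPc : Continuous P := (continuousOn_iff_continuous_domRestrict.1 hp).Icc_extend'
  have hQc : Continuous Q := (continuousOn_iff_continuous_domRestrict.1 hq).Icc_extend'
  have hPe : EqOn p P (Icc T₁ T₂) := fun t ht => by rw [hP, IccExtend_of_mem _ _ ht]; rfl
  have hQe : EqOn q Q (Icc T₁ T₂) := fun t ht => by rw [hQ, IccExtend_of_mem _ _ ht]; rfl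
  have hP0 : ∀ t, 0 < P t := fun t => hp0 _ (projIcc T₁ T₂ hT.le t).2
  have hQ0 : ∀ t, 0 ≤ Q t := fun t => hq0 _ (projIcc T₁ T₂ hT.le t).2
  have hpiece : ∀ k σ, fucikPiece T₁ T₂ p q m n k σ = fucikPiece T₁ T₂ P Q m n k σ := by
    intro k σ
    ext ⟨a, b⟩
    exact mem_fucikPiece_congr hPe hQe (fun _ => rfl) (fun _ => rfl) k σ
  have key := fun k hk σ => fucikPiece_inter_quadrant hT hPc hQc hm hn hP0 hQ0 ε₁ ε₂ (k := k) hk σ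
  simp only [← hpiece] at key
  refine ⟨?_, fun i hi => (key i.1 hi.1 i.2).2 hi.2, ?_⟩
  · ext x
    simp only [fucikStar, curveIndices, mem_inter_iff, mem_iUnion, mem_union, exists_prop]
    constructor
    · rintro ⟨⟨k, hk, h | h⟩, hx⟩
      · exact ⟨(k, 1), ⟨hk, x, h, hx⟩, h, hx⟩
      · exact ⟨(k, -1), ⟨hk, x, h, hx⟩, h, hx⟩
    · rintro ⟨⟨k, σ⟩, ⟨hk, -⟩, h, hx⟩
      refine ⟨⟨k, hk, ?_⟩, hx⟩
      rcases Int.units_eq_one_or σ with rfl | rfl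
      · exact Or.inl h
      · exact Or.inr h
  · rw [← hN]
    congr 1
    ext i
    exact and_congr_right fun hi => (key i.1 hi i.2).1

/-! ### Combinatorics of alternating chains -/

/-- The effect of a new last interval on the maximal lengths of the chains that end with the first
or with the second type of points; `x`, `y` tell if the points of the interval have these types. -/
noncomputable def chainStep (x y : Prop) [Decidable x] [Decidable y] (s : ℕ∞ × ℕ∞) : ℕ∞ × ℕ∞ :=
  if x then (if y then (⊤, ⊤) else (max s.1 (s.2 + 1), s.2))
  else if y then (s.1, max s.2 (s.1 + 1)) else s

theorem HasChain.mono {S S' : ℤ → Set ℝ} (hS : ∀ j, S j ⊆ S' j) : ∀ {l : ℕ} {j : ℤ} {s s' : ℝ},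
    s ≤ s' → HasChain S l j s → HasChain S' l j s'
  | 0, _, _, _, _, _ => trivial
  | _ + 1, _, _, _, hs, ⟨t, hts, ht, h⟩ => ⟨t, hts.trans_le hs, hS _ ht, h.mono hS le_rfl⟩

/-- `c j` is the maximal length of chains with last index `j`. If the new interval serves both
parities, chains of any length fit inside it. If it serves only `j`, it can contribute just the last
point, which prolongs a chain with last index `j - 1`. -/
theorem hasChain_append_iff {S : ℤ → Set ℝ} {χ : ℤ → Prop} [DecidablePred χ] {c : ℤ → ℕ∞}
    {τ τ' : ℝ} (hτ : τ < τ') (hS : ∀ j, S j ⊆ Iio τ) (hχ : ∀ j, χ (j - 1 - 1) ↔ χ j)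
    (hc : ∀ (l : ℕ) j, HasChain S l j τ ↔ (l : ℕ∞) ≤ c j) (l : ℕ) (j : ℤ) :
    HasChain (fun j => S j ∪ if χ j then Ioo τ τ' else ∅) l j τ' ↔
      (l : ℕ∞) ≤ if χ j then (if χ (j - 1) then ⊤ else max (c j) (c (j - 1) + 1)) else c j := by
  set S' : ℤ → Set ℝ := fun j => S j ∪ if χ j then Ioo τ τ' else ∅ with hS'
  have hsub : ∀ j, S j ⊆ S' j := fun j => subset_union_left
  have hbelow : ∀ (l : ℕ) (j : ℤ) (s : ℝ), s ≤ τ → HasChain S' l j s → HasChain S l j s := by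
    intro l
    induction l with
    | zero => exact fun _ _ _ _ => trivial
    | succ l ih =>
      rintro j s hs ⟨t, hts, ht, h⟩
      have htτ := hts.trans_le hs
      refine ⟨t, hts, ht.resolve_right fun h' => ?_, ih _ _ htτ.le h⟩
      split_ifs at h' with hj
      · exact h'.1.not_gt htτ
      · exact h'
  have hnot : ∀ (l : ℕ) (j : ℤ) (s : ℝ), ¬χ j → HasChain S' l j s → HasChain S l j τ := by
    rintro (_ | l) j s hj h
    · trivial
    · obtain ⟨t, _, ht, h⟩ := h
      have ht : t ∈ S j := by simpa [hS', hj] using ht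
      exact ⟨t, hS j ht, ht, hbelow _ _ _ (hS j ht : t < τ).le h⟩
  by_cases hj : χ j
  · rw [if_pos hj]
    by_cases hj' : χ (j - 1)
    · rw [if_pos hj']
      refine iff_of_true ?_ le_top
      have hall : ∀ (l : ℕ) (j : ℤ), χ j → χ (j - 1) → ∀ s, τ < s → s ≤ τ' →
          HasChain S' l j s := by
        intro l
        induction l with
        | zero => exact fun _ _ _ _ _ _ => trivial
        | succ l ih =>
          intro j h1 h2 s hs hs'
          obtain ⟨t, ht1, ht2⟩ := exists_between hs
          refine ⟨t, ht2, Or.inr ?_, ih (j - 1) h2 ((hχ j).2 h1) t ht1 (ht2.le.trans hs')⟩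
          rw [if_pos h1]
          exact ⟨ht1, ht2.trans_le hs'⟩
      exact hall l j hj hj' τ' hτ le_rfl
    · rw [if_neg hj']
      rcases l with _ | l
      · exact iff_of_true trivial (by simp)
      · have e : ((l + 1 : ℕ) : ℕ∞) ≤ max (c j) (c (j - 1) + 1) ↔
            HasChain S (l + 1) j τ ∨ HasChain S l (j - 1) τ := by
          rw [le_max_iff, hc, hc, Nat.cast_add, Nat.cast_one,
            ENat.add_le_add_iff_right (by simp)]
        rw [e]
        constructor
        · rintro ⟨t, htτ', ht, h⟩
          rcases ht with ht | ht
          · exact Or.inl ⟨t, hS j ht, ht, hbelow _ _ _ (hS j ht : t < τ).le h⟩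
          · exact Or.inr (hnot _ _ _ hj' h)
        · rintro (h | h)
          · exact h.mono hsub hτ.le
          · obtain ⟨t, ht1, ht2⟩ := exists_between hτ
            refine ⟨t, ht2, Or.inr ?_, h.mono hsub ht1.le⟩
            rw [if_pos hj]
            exact ⟨ht1, ht2⟩
  · rw [if_neg hj, ← hc]
    exact ⟨hnot _ _ _ hj, fun h => h.mono hsub hτ.le⟩

/-- There are open sets `A ±1` and `B ±1` such that the maximal lengths of the alternating chains of
points of `A ε₁` and `B ε₂` are `L ε₁ ε₂`; its components belong to the chains that end in `A ε₁`
and in `B ε₂`. -/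
def Realizable (T₁ T₂ : ℝ) (L : ℤˣ → ℤˣ → ℕ∞ × ℕ∞) : Prop :=
  ∀ τ ∈ Ioo T₁ T₂, ∃ A B : ℤˣ → Set ℝ, (∀ ε, IsOpen (A ε) ∧ A ε ⊆ Ioo T₁ τ) ∧
    (∀ ε, IsOpen (B ε) ∧ B ε ⊆ Ioo T₁ τ) ∧ Disjoint (A 1) (A (-1)) ∧ Disjoint (B 1) (B (-1)) ∧
    ∀ (ε₁ ε₂ : ℤˣ) (l : ℕ) (j : ℤ), HasChain (fun j => if Even j then A ε₁ else B ε₂) l j τ ↔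
      (l : ℕ∞) ≤ if Even j then (L ε₁ ε₂).1 else (L ε₁ ε₂).2

theorem realizable_zero (T₁ T₂ : ℝ) : Realizable T₁ T₂ fun _ _ => (0, 0) := by
  intro τ _
  refine ⟨fun _ => ∅, fun _ => ∅, fun _ => ⟨isOpen_empty, empty_subset _⟩,
    fun _ => ⟨isOpen_empty, empty_subset _⟩, by simp, by simp, fun _ _ l j => ?_⟩
  rcases l with _ | l <;> simp [HasChain]

theorem Realizable.append {T₁ T₂ : ℝ} {L : ℤˣ → ℤˣ → ℕ∞ × ℕ∞} (h : Realizable T₁ T₂ L)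
    (μ ν : Option ℤˣ) :
    Realizable T₁ T₂ fun ε₁ ε₂ => chainStep (μ = some ε₁) (ν = some ε₂) (L ε₁ ε₂) := by
  intro τ' hτ'
  -- The old sets are squeezed below `τ`, which frees `Ioo τ τ'` for the new interval; this is why
  -- `Realizable` quantifies over the right end.
  obtain ⟨τ, hτ1, hτ⟩ := exists_between hτ'.1
  obtain ⟨A, B, hA, hB, hAd, hBd, hch⟩ := h τ ⟨hτ1, hτ.trans hτ'.2⟩
  have hadd : ∀ {A : ℤˣ → Set ℝ} (_ : ∀ ε, IsOpen (A ε) ∧ A ε ⊆ Ioo T₁ τ) (μ : Option ℤˣ),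
      ∀ ε, IsOpen (A ε ∪ if μ = some ε then Ioo τ τ' else ∅) ∧
        (A ε ∪ if μ = some ε then Ioo τ τ' else ∅) ⊆ Ioo T₁ τ' := by
    intro A hA μ ε
    refine ⟨(hA ε).1.union (by split_ifs <;> simp [isOpen_Ioo]), union_subset
      ((hA ε).2.trans (Ioo_subset_Ioo_right hτ.le)) ?_⟩
    split_ifs
    · exact Ioo_subset_Ioo_left hτ1.le
    · exact empty_subset _
  have hdisj : ∀ {A : ℤˣ → Set ℝ} (_ : ∀ ε, IsOpen (A ε) ∧ A ε ⊆ Ioo T₁ τ)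
      (_ : Disjoint (A 1) (A (-1))) (μ : Option ℤˣ),
      Disjoint (A 1 ∪ if μ = some 1 then Ioo τ τ' else ∅)
        (A (-1) ∪ if μ = some (-1) then Ioo τ τ' else ∅) := by
    intro A hA hd μ
    have h1 : ∀ ε, Disjoint (A ε) (Ioo τ τ') := fun ε =>
      disjoint_left.2 fun t ht ht' => ((hA ε).2 ht).2.not_gt ht'.1
    rcases μ with _ | μ
    · simpa using hd
    · rcases Int.units_eq_one_or μ with rfl | rfl
      · simpa [hd] using (h1 (-1)).symm
      · simpa [hd] using h1 1
  refine ⟨_, _, hadd hA μ, hadd hB ν, hdisj hA hAd μ, hdisj hB hBd ν, fun ε₁ ε₂ l j => ?_⟩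
  have := hasChain_append_iff (χ := fun j => if Even j then μ = some ε₁ else ν = some ε₂)
    (S := fun j => if Even j then A ε₁ else B ε₂) hτ
    (fun j => by
      split_ifs
      · exact fun t ht => ((hA ε₁).2 ht).2
      · exact fun t ht => ((hB ε₂).2 ht).2)
    (fun j => by simp) (hch ε₁ ε₂) l j
  have e : (fun j : ℤ => (if Even j then A ε₁ else B ε₂) ∪
      if (if Even j then μ = some ε₁ else ν = some ε₂) then Ioo τ τ' else ∅) =
      fun j : ℤ => if Even j then A ε₁ ∪ (if μ = some ε₁ then Ioo τ τ' else ∅)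
        else B ε₂ ∪ if ν = some ε₂ then Ioo τ τ' else ∅ := by
    funext j
    split_ifs <;> rfl
  rw [e] at this
  rw [this]
  have hsub : Even (j - 1) ↔ ¬Even j := Int.even_sub_one
  unfold chainStep
  simp only [hsub]
  by_cases hj : Even j <;> by_cases h1 : μ = some ε₁ <;> by_cases h2 : ν = some ε₂ <;>
    simp [hj, h1, h2]

/-- The maximal lengths of chains when the last point is of the first (`some true`) or of the
second type (`some false`) and `n` alternations occur. -/
def chainLengths : Option Bool × ℕ∞ → ℕ∞ × ℕ∞
  | (none, _) => (0, 0)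
  | (some true, n) => (n + 1, n)
  | (some false, n) => (n, n + 1)

/-- The new state after a point of the first type. -/
def stepFirst : Option Bool × ℕ∞ → Option Bool × ℕ∞
  | (none, _) => (some true, 0)
  | (some true, n) => (some true, n)
  | (some false, n) => (some true, n + 1)

/-- The new state after a point of the second type. -/
def stepSecond : Option Bool × ℕ∞ → Option Bool × ℕ∞
  | (none, _) => (some false, 0)
  | (some false, n) => (some false, n)
  | (some true, n) => (some false, n + 1)

theorem chainStep_first {x y : Prop} [Decidable x] [Decidable y] (hx : x) (hy : ¬y)
    (s : Option Bool × ℕ∞) : chainStep x y (chainLengths s) = chainLengths (stepFirst s) := by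
  rcases s with ⟨_ | _ | _, n⟩ <;> simp [chainStep, chainLengths, stepFirst, hx, hy]
  exact le_self_add.trans le_self_add

theorem chainStep_second {x y : Prop} [Decidable x] [Decidable y] (hx : ¬x) (hy : y)
    (s : Option Bool × ℕ∞) : chainStep x y (chainLengths s) = chainLengths (stepSecond s) := by
  rcases s with ⟨_ | _ | _, n⟩ <;> simp [chainStep, chainLengths, stepSecond, hx, hy]
  exact le_self_add.trans le_self_add

theorem chainStep_neither {x y : Prop} [Decidable x] [Decidable y] (hx : ¬x) (hy : ¬y)
    (s : ℕ∞ × ℕ∞) : chainStep x y s = s := by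
  simp [chainStep, hx, hy]

/-- Infinite lengths are treated as infinitely many repetitions, with the last kind kept formally.
-/
theorem chainStep_both {x y : Prop} [Decidable x] [Decidable y] (hx : x) (hy : y)
    {s : Option Bool × ℕ∞} (hs : s.1.isSome) (s' : ℕ∞ × ℕ∞) :
    chainStep x y s' = chainLengths (s.1, s.2 + 2 * ⊤) := by
  rcases s with ⟨_ | _ | _, n⟩ <;> simp_all [chainStep, chainLengths, ENat.mul_top]

/-- The four values for the signs `(1, 1)`, `(1, -1)`, `(-1, 1)`, `(-1, -1)`. -/
def bySigns (s₁ s₂ s₃ s₄ : Option Bool × ℕ∞) (ε₁ ε₂ : ℤˣ) : Option Bool × ℕ∞ :=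
  if ε₁ = 1 then (if ε₂ = 1 then s₁ else s₂) else if ε₂ = 1 then s₃ else s₄

/-- The given states of the four pairs of signs are realizable by open sets. -/
def Reachable (T₁ T₂ : ℝ) (s₁ s₂ s₃ s₄ : Option Bool × ℕ∞) : Prop :=
  Realizable T₁ T₂ fun ε₁ ε₂ => chainLengths (bySigns s₁ s₂ s₃ s₄ ε₁ ε₂)

theorem reachable_nil (T₁ T₂ : ℝ) : Reachable T₁ T₂ (none, 0) (none, 0) (none, 0) (none, 0) := by
  have : (fun ε₁ ε₂ : ℤˣ => chainLengths (bySigns (none, 0) (none, 0) (none, 0) (none, 0) ε₁ ε₂)) =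
      fun _ _ => (0, 0) := by
    funext ε₁ ε₂
    simp [bySigns, chainLengths]
  unfold Reachable
  rw [this]
  exact realizable_zero T₁ T₂

theorem Realizable.congr {T₁ T₂ : ℝ} {L L' : ℤˣ → ℤˣ → ℕ∞ × ℕ∞} (h : Realizable T₁ T₂ L)
    (h₁ : L 1 1 = L' 1 1) (h₂ : L 1 (-1) = L' 1 (-1)) (h₃ : L (-1) 1 = L' (-1) 1)
    (h₄ : L (-1) (-1) = L' (-1) (-1)) : Realizable T₁ T₂ L' := by
  have : L = L' := by
    funext ε₁ ε₂
    rcases Int.units_eq_one_or ε₁ with rfl | rfl <;> rcases Int.units_eq_one_or ε₂ with rfl | rfl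
        <;>
      assumption
  exact this ▸ h

namespace Reachable

variable {T₁ T₂ : ℝ} {s₁ s₂ s₃ s₄ : Option Bool × ℕ∞}

theorem posLeft (h : Reachable T₁ T₂ s₁ s₂ s₃ s₄) :
    Reachable T₁ T₂ (stepFirst s₁) (stepFirst s₂) s₃ s₄ :=
  (Realizable.append h (some 1) none).congr (chainStep_first (by decide) (by decide) s₁)
    (chainStep_first (by decide) (by decide) s₂) (chainStep_neither (by decide) (by decide) _)
    (chainStep_neither (by decide) (by decide) _)

theorem negLeft (h : Reachable T₁ T₂ s₁ s₂ s₃ s₄) :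
    Reachable T₁ T₂ s₁ s₂ (stepFirst s₃) (stepFirst s₄) :=
  (Realizable.append h (some (-1)) none).congr (chainStep_neither (by decide) (by decide) _)
    (chainStep_neither (by decide) (by decide) _) (chainStep_first (by decide) (by decide) s₃)
    (chainStep_first (by decide) (by decide) s₄)

theorem posRight (h : Reachable T₁ T₂ s₁ s₂ s₃ s₄) :
    Reachable T₁ T₂ (stepSecond s₁) s₂ (stepSecond s₃) s₄ :=
  (Realizable.append h none (some 1)).congr (chainStep_second (by decide) (by decide) s₁)
    (chainStep_neither (by decide) (by decide) _) (chainStep_second (by decide) (by decide) s₃)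
    (chainStep_neither (by decide) (by decide) _)

theorem negRight (h : Reachable T₁ T₂ s₁ s₂ s₃ s₄) :
    Reachable T₁ T₂ s₁ (stepSecond s₂) s₃ (stepSecond s₄) :=
  (Realizable.append h none (some (-1))).congr (chainStep_neither (by decide) (by decide) _)
    (chainStep_second (by decide) (by decide) s₂) (chainStep_neither (by decide) (by decide) _)
    (chainStep_second (by decide) (by decide) s₄)

theorem stepFirst_eq_self {s : Option Bool × ℕ∞} (hs : s.1 = some true) : stepFirst s = s := by
  obtain ⟨o, n⟩ := s
  simp only at hs
  subst hs
  rfl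

theorem stepSecond_eq_self {s : Option Bool × ℕ∞} (hs : s.1 = some false) : stepSecond s = s := by
  obtain ⟨o, n⟩ := s
  simp only at hs
  subst hs
  rfl

/-- Finite `x` is reached by repeating the two steps, `x = ⊤` by an interval on which both weights
are nonzero. -/
theorem add_two_mul_of_step {R : Option Bool × ℕ∞ → Prop} {s : Option Bool × ℕ∞}
    (hs : s.1.isSome) (h : R s) (hfirst : ∀ s, R s → R (stepFirst s))
    (hsecond : ∀ s, R s → R (stepSecond s)) (htop : ∀ s, s.1.isSome → R s → R (s.1, s.2 + 2 * ⊤))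
    (x : ℕ∞) : R (s.1, s.2 + 2 * x) := by
  induction x using ENat.recTopCoe with
  | top => exact htop s hs h
  | coe k =>
    obtain ⟨o, n⟩ := s
    induction k with
    | zero => simpa using h
    | succ k ih =>
      have e : n + 2 * ((k + 1 : ℕ) : ℕ∞) = n + 2 * (k : ℕ∞) + 1 + 1 := by
        push_cast; ring
      simp only at ih ⊢
      rw [e]
      -- The kind different from the last one comes first, so that both steps alternate and the last
      -- kind is restored.
      match o, hs, ih with
      | some true, _, ih => exact hfirst _ (hsecond _ ih)
      | some false, _, ih => exact hsecond _ (hfirst _ ih)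

/-- The intervals used are those with m > 0 and with n > 0. The quadrant (+, −) sees only the former
and (−, +) only the latter; `h₂` and `h₃` say that they already end so, hence they do not change. -/
theorem oscPosPos (h : Reachable T₁ T₂ s₁ s₂ s₃ s₄) (x : ℕ∞) (h₁ : s₁.1.isSome)
    (h₂ : s₂.1 = some true) (h₃ : s₃.1 = some false) :
    Reachable T₁ T₂ (s₁.1, s₁.2 + 2 * x) s₂ s₃ s₄ := by
  refine add_two_mul_of_step (R := fun s => Reachable T₁ T₂ s s₂ s₃ s₄) h₁ h
    (fun s hs => ?_) (fun s hs => ?_) (fun s hs h => ?_) x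
  · simpa [stepFirst_eq_self h₂] using hs.posLeft
  · simpa [stepSecond_eq_self h₃] using hs.posRight
  · refine (Realizable.append h (some 1) (some 1)).congr
      (chainStep_both (by decide) (by decide) hs _) ?_ ?_
      (chainStep_neither (by decide) (by decide) _)
    · exact (chainStep_first (by decide) (by decide) s₂).trans (by rw [stepFirst_eq_self h₂]; rfl)
    · exact (chainStep_second (by decide) (by decide) s₃).trans (by rw [stepSecond_eq_self h₃]; rfl)

theorem oscPosNeg (h : Reachable T₁ T₂ s₁ s₂ s₃ s₄) (x : ℕ∞) (h₁ : s₁.1 = some true)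
    (h₂ : s₂.1.isSome) (h₄ : s₄.1 = some false) :
    Reachable T₁ T₂ s₁ (s₂.1, s₂.2 + 2 * x) s₃ s₄ := by
  refine add_two_mul_of_step (R := fun s => Reachable T₁ T₂ s₁ s s₃ s₄) h₂ h
    (fun s hs => ?_) (fun s hs => ?_) (fun s hs h => ?_) x
  · simpa [stepFirst_eq_self h₁] using hs.posLeft
  · simpa [stepSecond_eq_self h₄] using hs.negRight
  · refine (Realizable.append h (some 1) (some (-1))).congr ?_
      (chainStep_both (by decide) (by decide) hs _) (chainStep_neither (by decide) (by decide) _) ?_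
    · exact (chainStep_first (by decide) (by decide) s₁).trans (by rw [stepFirst_eq_self h₁]; rfl)
    · exact (chainStep_second (by decide) (by decide) s₄).trans (by rw [stepSecond_eq_self h₄]; rfl)

theorem oscNegPos (h : Reachable T₁ T₂ s₁ s₂ s₃ s₄) (x : ℕ∞) (h₁ : s₁.1 = some false)
    (h₃ : s₃.1.isSome) (h₄ : s₄.1 = some true) :
    Reachable T₁ T₂ s₁ s₂ (s₃.1, s₃.2 + 2 * x) s₄ := by
  refine add_two_mul_of_step (R := fun s => Reachable T₁ T₂ s₁ s₂ s s₄) h₃ h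
    (fun s hs => ?_) (fun s hs => ?_) (fun s hs h => ?_) x
  · simpa [stepFirst_eq_self h₄] using hs.negLeft
  · simpa [stepSecond_eq_self h₁] using hs.posRight
  · refine (Realizable.append h (some (-1)) (some 1)).congr ?_
      (chainStep_neither (by decide) (by decide) _) (chainStep_both (by decide) (by decide) hs _) ?_
    · exact (chainStep_second (by decide) (by decide) s₁).trans (by rw [stepSecond_eq_self h₁]; rfl)
    · exact (chainStep_first (by decide) (by decide) s₄).trans (by rw [stepFirst_eq_self h₄]; rfl)

theorem oscNegNeg (h : Reachable T₁ T₂ s₁ s₂ s₃ s₄) (x : ℕ∞) (h₂ : s₂.1 = some false)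
    (h₃ : s₃.1 = some true) (h₄ : s₄.1.isSome) :
    Reachable T₁ T₂ s₁ s₂ s₃ (s₄.1, s₄.2 + 2 * x) := by
  refine add_two_mul_of_step (R := fun s => Reachable T₁ T₂ s₁ s₂ s₃ s) h₄ h
    (fun s hs => ?_) (fun s hs => ?_) (fun s hs h => ?_) x
  · simpa [stepFirst_eq_self h₃] using hs.negLeft
  · simpa [stepSecond_eq_self h₂] using hs.negRight
  · refine (Realizable.append h (some (-1)) (some (-1))).congr
      (chainStep_neither (by decide) (by decide) _) ?_ ?_
      (chainStep_both (by decide) (by decide) hs _)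
    · exact (chainStep_second (by decide) (by decide) s₂).trans (by rw [stepSecond_eq_self h₂]; rfl)
    · exact (chainStep_first (by decide) (by decide) s₃).trans (by rw [stepFirst_eq_self h₃]; rfl)

end Reachable

/-- The value `⊤` is taken as even, being `2 * ⊤`. -/
theorem ENat.even_or_odd (p : ℕ∞) : ∃ x, p = 2 * x ∨ p = 2 * x + 1 := by
  induction p using ENat.recTopCoe with
  | top => exact ⟨⊤, Or.inl (by simp [ENat.mul_top])⟩
  | coe k =>
    obtain ⟨i, hi | hi⟩ := Nat.even_or_odd' k
    · exact ⟨i, Or.inl (by rw [hi]; push_cast; rfl)⟩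
    · exact ⟨i, Or.inr (by rw [hi]; push_cast; rfl)⟩

/-- All numbers of alternations are possible. -/
theorem exists_reachable (T₁ T₂ : ℝ) (n₁ n₂ n₃ n₄ : ℕ∞) :
    ∃ s₁ s₂ s₃ s₄, Reachable T₁ T₂ s₁ s₂ s₃ s₄ ∧
    (s₁.1.isSome ∧ s₁.2 = n₁ + 1) ∧ (s₂.1.isSome ∧ s₂.2 = n₂ + 1) ∧
    (s₃.1.isSome ∧ s₃.2 = n₃ + 1) ∧ (s₄.1.isSome ∧ s₄.2 = n₄ + 1) := by
  obtain ⟨x₁, h₁⟩ := ENat.even_or_odd n₁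
  obtain ⟨x₂, h₂⟩ := ENat.even_or_odd n₂
  obtain ⟨x₃, h₃⟩ := ENat.even_or_odd n₃
  obtain ⟨x₄, h₄⟩ := ENat.even_or_odd n₄
  rcases h₁ with rfl | rfl <;> rcases h₂ with rfl | rfl <;> rcases h₃ with rfl | rfl <;>
    rcases h₄ with rfl | rfl
  -- One word for each parity pattern: its single letters give one alternation to an even number and
  -- two to an odd one, and the `osc` steps add the rest. When all four are even, two words are
  -- used: either the quadrant (+, +) needs no oscillation, or three of its alternations come from
  -- single letters, whence `x₁ = y + 1`.
  · rcases eq_or_ne x₁ 0 with rfl | hx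
    · refine ⟨_, _, _, _, ((((reachable_nil T₁ T₂).posLeft.negRight.oscPosNeg x₂ rfl rfl
        rfl).negLeft.oscNegNeg x₄ rfl rfl rfl).posRight.oscNegPos x₃ rfl rfl rfl),
        ?_, ?_, ?_, ?_⟩ <;> exact ⟨rfl, by simp only [stepFirst, stepSecond]; ring⟩
    · obtain ⟨x₁, rfl⟩ : ∃ y, x₁ = y + 1 := ⟨x₁ - 1, (tsub_add_cancel_of_le
        (Order.one_le_iff_ne_zero.2 hx)).symm⟩
      refine ⟨_, _, _, _, (((((reachable_nil T₁ T₂).posLeft.posRight.oscPosPos x₁ rfl rfl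
          rfl).posLeft.negRight.oscPosNeg x₂ rfl rfl rfl).posRight.negLeft.oscNegPos x₃ rfl rfl
          rfl).oscNegNeg x₄ rfl rfl rfl),
        ?_, ?_, ?_, ?_⟩ <;> exact ⟨rfl, by simp only [stepFirst, stepSecond]; ring⟩
  · refine ⟨_, _, _, _, (((((reachable_nil T₁ T₂).negLeft.negRight.oscNegNeg x₄ rfl rfl
      rfl).posLeft.oscPosNeg x₂ rfl rfl rfl).negLeft.posRight.oscPosPos x₁ rfl rfl rfl).oscNegPos
      x₃ rfl rfl rfl),
      ?_, ?_, ?_, ?_⟩ <;> exact ⟨rfl, by simp only [stepFirst, stepSecond]; ring⟩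
  · refine ⟨_, _, _, _, (((((reachable_nil T₁ T₂).negLeft.posRight.oscNegPos x₃ rfl rfl
      rfl).posLeft.oscPosPos x₁ rfl rfl rfl).negLeft.negRight.oscPosNeg x₂ rfl rfl rfl).oscNegNeg
      x₄ rfl rfl rfl),
      ?_, ?_, ?_, ?_⟩ <;> exact ⟨rfl, by simp only [stepFirst, stepSecond]; ring⟩
  · refine ⟨_, _, _, _, (((((reachable_nil T₁ T₂).negLeft.posRight.oscNegPos x₃ rfl rfl
      rfl).posLeft.oscPosPos x₁ rfl rfl rfl).negRight.oscPosNeg x₂ rfl rfl rfl).negLeft.oscNegNeg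
      x₄ rfl rfl rfl),
      ?_, ?_, ?_, ?_⟩ <;> exact ⟨rfl, by simp only [stepFirst, stepSecond]; ring⟩
  · refine ⟨_, _, _, _, (((((reachable_nil T₁ T₂).posLeft.negRight.oscPosNeg x₂ rfl rfl
      rfl).negLeft.oscNegNeg x₄ rfl rfl rfl).posLeft.posRight.oscPosPos x₁ rfl rfl rfl).oscNegPos
      x₃ rfl rfl rfl),
      ?_, ?_, ?_, ?_⟩ <;> exact ⟨rfl, by simp only [stepFirst, stepSecond]; ring⟩
  · refine ⟨_, _, _, _, (((((reachable_nil T₁ T₂).negRight.posLeft.oscPosNeg x₂ rfl rfl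
      rfl).posRight.oscPosPos x₁ rfl rfl rfl).negLeft.oscNegPos x₃ rfl rfl rfl).negRight.oscNegNeg
      x₄ rfl rfl rfl),
      ?_, ?_, ?_, ?_⟩ <;> exact ⟨rfl, by simp only [stepFirst, stepSecond]; ring⟩
  · refine ⟨_, _, _, _, (((((reachable_nil T₁ T₂).posLeft.negRight.oscPosNeg x₂ rfl rfl
      rfl).negLeft.oscNegNeg x₄ rfl rfl rfl).posLeft.posRight.oscPosPos x₁ rfl rfl rfl).oscNegPos
      x₃ rfl rfl rfl).negLeft,
      ?_, ?_, ?_, ?_⟩ <;> exact ⟨rfl, by simp only [stepFirst, stepSecond]; ring⟩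
  · refine ⟨_, _, _, _, (((((reachable_nil T₁ T₂).posLeft.negLeft.negRight.oscPosNeg x₂ rfl rfl
      rfl).oscNegNeg x₄ rfl rfl rfl).posLeft.posRight.oscPosPos x₁ rfl rfl rfl).negLeft.oscNegPos
      x₃ rfl rfl rfl),
      ?_, ?_, ?_, ?_⟩ <;> exact ⟨rfl, by simp only [stepFirst, stepSecond]; ring⟩
  · refine ⟨_, _, _, _, (((((reachable_nil T₁ T₂).posLeft.posRight.oscPosPos x₁ rfl rfl
      rfl).negLeft.oscNegPos x₃ rfl rfl rfl).posLeft.negRight.oscPosNeg x₂ rfl rfl rfl).oscNegNeg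
      x₄ rfl rfl rfl),
      ?_, ?_, ?_, ?_⟩ <;> exact ⟨rfl, by simp only [stepFirst, stepSecond]; ring⟩
  · refine ⟨_, _, _, _, (((((reachable_nil T₁ T₂).posLeft.posRight.oscPosPos x₁ rfl rfl
      rfl).negLeft.oscNegPos x₃ rfl rfl rfl).posLeft.negRight.oscPosNeg x₂ rfl rfl rfl).oscNegNeg
      x₄ rfl rfl rfl).negLeft,
      ?_, ?_, ?_, ?_⟩ <;> exact ⟨rfl, by simp only [stepFirst, stepSecond]; ring⟩
  · refine ⟨_, _, _, _, (((((reachable_nil T₁ T₂).posRight.posLeft.oscPosPos x₁ rfl rfl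
      rfl).negRight.oscPosNeg x₂ rfl rfl rfl).negLeft.oscNegNeg x₄ rfl rfl rfl).posRight.oscNegPos
      x₃ rfl rfl rfl),
      ?_, ?_, ?_, ?_⟩ <;> exact ⟨rfl, by simp only [stepFirst, stepSecond]; ring⟩
  · refine ⟨_, _, _, _, (((((reachable_nil T₁ T₂).posLeft.negLeft.posRight.oscPosPos x₁ rfl rfl
      rfl).oscNegPos x₃ rfl rfl rfl).posLeft.negRight.oscPosNeg x₂ rfl rfl rfl).negLeft.oscNegNeg
      x₄ rfl rfl rfl),
      ?_, ?_, ?_, ?_⟩ <;> exact ⟨rfl, by simp only [stepFirst, stepSecond]; ring⟩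
  · refine ⟨_, _, _, _, (((((reachable_nil T₁ T₂).posLeft.posRight.oscPosPos x₁ rfl rfl
      rfl).negLeft.oscNegPos x₃ rfl rfl rfl).negRight.oscNegNeg x₄ rfl rfl rfl).posLeft.oscPosNeg
      x₂ rfl rfl rfl),
      ?_, ?_, ?_, ?_⟩ <;> exact ⟨rfl, by simp only [stepFirst, stepSecond]; ring⟩
  · refine ⟨_, _, _, _, (((((reachable_nil T₁ T₂).posLeft.negLeft.negRight.oscPosNeg x₂ rfl rfl
      rfl).oscNegNeg x₄ rfl rfl rfl).negLeft.posRight.oscNegPos x₃ rfl rfl rfl).posLeft.oscPosPos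
      x₁ rfl rfl rfl),
      ?_, ?_, ?_, ?_⟩ <;> exact ⟨rfl, by simp only [stepFirst, stepSecond]; ring⟩
  · refine ⟨_, _, _, _, (((((reachable_nil T₁ T₂).posLeft.negLeft.posRight.oscPosPos x₁ rfl rfl
      rfl).oscNegPos x₃ rfl rfl rfl).negLeft.negRight.oscNegNeg x₄ rfl rfl rfl).posLeft.oscPosNeg
      x₂ rfl rfl rfl),
      ?_, ?_, ?_, ?_⟩ <;> exact ⟨rfl, by simp only [stepFirst, stepSecond]; ring⟩
  · refine ⟨_, _, _, _, (((((reachable_nil T₁ T₂).posLeft.negLeft.posRight.oscPosPos x₁ rfl rfl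
      rfl).oscNegPos x₃ rfl rfl rfl).posLeft.negRight.oscPosNeg x₂ rfl rfl rfl).negLeft.oscNegNeg
      x₄ rfl rfl rfl).posLeft,
      ?_, ?_, ?_, ?_⟩ <;> exact ⟨rfl, by simp only [stepFirst, stepSecond]; ring⟩

/-! ### Counting the curves and constructing the weights -/

theorem encard_setOf_one_le_and_lt (N : ℕ∞) :
    {k : ℕ | 1 ≤ k ∧ ((k + 1 : ℕ) : ℕ∞) ≤ N + 1}.encard = N := by
  have h : ∀ k : ℕ, ((k + 1 : ℕ) : ℕ∞) ≤ N + 1 ↔ (k : ℕ∞) ≤ N := fun k => by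
    rw [Nat.cast_add, Nat.cast_one, ENat.add_le_add_iff_right (by simp)]
  simp only [h]
  induction N using ENat.recTopCoe with
  | top =>
    simp only [le_top, and_true]
    exact (Ici_infinite 1).encard_eq
  | coe n =>
    have : {k : ℕ | 1 ≤ k ∧ (k : ℕ∞) ≤ n} = (Finset.Icc 1 n : Set ℕ) := by
      ext k; simp
    rw [this, encard_coe_eq_coe_finsetCard, Nat.card_Icc]
    simp

/-- The two maximal lengths are `N + 2` and `N + 1` in some order; chains of length `k + 1` with `k
≥ 1` leave `N + 1` and `N` values of `k`. -/
theorem encard_chain_indices {s : Option Bool × ℕ∞} (hs : s.1.isSome) {N : ℕ∞}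
    (hN : s.2 = N + 1) :
    {i : ℕ × ℤˣ | 1 ≤ i.1 ∧ ((i.1 + 1 : ℕ) : ℕ∞) ≤
      if Even (signIndex i.2) then (chainLengths s).1 else (chainLengths s).2}.encard
      = 2 * N + 1 := by
  have hset : {i : ℕ × ℤˣ | 1 ≤ i.1 ∧ ((i.1 + 1 : ℕ) : ℕ∞) ≤
      if Even (signIndex i.2) then (chainLengths s).1 else (chainLengths s).2} =
      (fun k => (k, (1 : ℤˣ))) '' {k : ℕ | 1 ≤ k ∧ ((k + 1 : ℕ) : ℕ∞) ≤ (chainLengths s).1} ∪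
      (fun k => (k, (-1 : ℤˣ))) '' {k : ℕ | 1 ≤ k ∧ ((k + 1 : ℕ) : ℕ∞) ≤ (chainLengths s).2} := by
    ext ⟨k, σ⟩
    rcases Int.units_eq_one_or σ with rfl | rfl <;> simp [signIndex]
  have hdisj : Disjoint
      ((fun k => (k, (1 : ℤˣ))) '' {k : ℕ | 1 ≤ k ∧ ((k + 1 : ℕ) : ℕ∞) ≤ (chainLengths s).1})
      ((fun k => (k, (-1 : ℤˣ))) '' {k : ℕ | 1 ≤ k ∧ ((k + 1 : ℕ) : ℕ∞) ≤ (chainLengths s).2}) := by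
    rw [disjoint_left]
    rintro _ ⟨k, -, rfl⟩ ⟨k', -, h⟩
    have h2 : (-1 : ℤˣ) = 1 := (Prod.ext_iff.1 h).2
    exact absurd h2 (by decide)
  rw [hset, encard_union_eq hdisj, Function.Injective.encard_image, Function.Injective.encard_image]
  · obtain ⟨o, n⟩ := s
    simp only at hN
    subst hN
    match o, hs with
    | some true, _ =>
      simp only [chainLengths]
      rw [encard_setOf_one_le_and_lt, encard_setOf_one_le_and_lt]
      ring
    | some false, _ =>
      simp only [chainLengths]
      rw [encard_setOf_one_le_and_lt, encard_setOf_one_le_and_lt]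
      ring
  · exact fun a b h => (Prod.ext_iff.1 h).1
  · exact fun a b h => (Prod.ext_iff.1 h).1

/-- The difference of the distances to the two complements; by disjointness at most one of them is
nonzero. The complements must be nonempty because the distance to the empty set is 0 by convention.
-/
theorem exists_continuous_of_disjoint_open {A : ℤˣ → Set ℝ} (hA : ∀ ε, IsOpen (A ε))
    (hne : ∀ ε, (A ε)ᶜ.Nonempty) (hd : Disjoint (A 1) (A (-1))) :
    ∃ m : ℝ → ℝ, Continuous m ∧ ∀ (ε : ℤˣ) t, 0 < ((ε : ℤ) : ℝ) * m t ↔ t ∈ A ε := by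
  have hpos : ∀ ε t, 0 < Metric.infDist t (A ε)ᶜ ↔ t ∈ A ε := fun ε t => by
    rw [← (hA ε).isClosed_compl.notMem_iff_infDist_pos (hne ε), notMem_compl_iff]
  have hzero : ∀ ε t, t ∉ A ε → Metric.infDist t (A ε)ᶜ = 0 := fun ε t ht =>
    Metric.infDist_zero_of_mem ht
  refine ⟨fun t => Metric.infDist t (A 1)ᶜ - Metric.infDist t (A (-1))ᶜ,
    (Metric.continuous_infDist_pt _).sub (Metric.continuous_infDist_pt _), fun ε t => ?_⟩
  rcases Int.units_eq_one_or ε with rfl | rfl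
  · constructor
    · intro h
      rw [← hpos]
      have := Metric.infDist_nonneg (x := t) (s := (A (-1))ᶜ)
      simp only [Units.val_one, Int.cast_one, one_mul] at h
      linarith
    · intro h
      have h2 := hzero (-1) t (disjoint_left.1 hd h)
      have h3 := (hpos 1 t).2 h
      simp only [Units.val_one, Int.cast_one, one_mul]
      linarith
  · constructor
    · intro h
      rw [← hpos]
      have := Metric.infDist_nonneg (x := t) (s := (A 1)ᶜ)
      simp only [Units.val_neg, Units.val_one, Int.cast_neg, Int.cast_one] at h
      linarith
    · intro h
      have h2 := hzero 1 t (disjoint_right.1 hd h)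
      have h3 := (hpos (-1) t).2 h
      simp only [Units.val_neg, Units.val_one, Int.cast_neg, Int.cast_one]
      linarith

theorem theorem5 (T₁ T₂ : ℝ) (hT : T₁ < T₂) (pL qL : ℝ → ℝ)
    (hp : ContinuousOn pL (Set.Icc T₁ T₂)) (hq : ContinuousOn qL (Set.Icc T₁ T₂))
    (hp_pos : ∀ t ∈ Set.Icc T₁ T₂, 0 < pL t) (hq_nonneg : ∀ t ∈ Set.Icc T₁ T₂, 0 ≤ qL t)
    (p q r s : ℕ∞) :
    ∃ m n : ℝ → ℝ,
      ContinuousOn m (Set.Icc T₁ T₂) ∧ ContinuousOn n (Set.Icc T₁ T₂) ∧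
      (∃ t ∈ Set.Icc T₁ T₂, m t ≠ 0) ∧ (∃ t ∈ Set.Icc T₁ T₂, n t ≠ 0) ∧
      HasExactlyCurves T₁ T₂ pL qL m n 1 1 (2 * p + 1) ∧
      HasExactlyCurves T₁ T₂ pL qL m n 1 (-1) (2 * q + 1) ∧
      HasExactlyCurves T₁ T₂ pL qL m n (-1) (-1) (2 * r + 1) ∧
      HasExactlyCurves T₁ T₂ pL qL m n (-1) 1 (2 * s + 1) := by
  -- The states are ordered (+, +), (+, −), (−, +), (−, −), hence `s` precedes `r`.
  obtain ⟨s₁, s₂, s₃, s₄, hreach, h₁, h₂, h₃, h₄⟩ := exists_reachable T₁ T₂ p q s r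
  obtain ⟨τ, hτ₁, hτ₂⟩ := exists_between hT
  obtain ⟨A, B, hA, hB, hAd, hBd, hch⟩ := hreach τ ⟨hτ₁, hτ₂⟩
  have hcompl : ∀ {A : ℤˣ → Set ℝ} (_ : ∀ ε, IsOpen (A ε) ∧ A ε ⊆ Ioo T₁ τ) (ε : ℤˣ),
      (A ε)ᶜ.Nonempty := fun hA ε => ⟨T₁, fun h => ((hA ε).2 h).1.false⟩
  obtain ⟨m, hm, hmA⟩ := exists_continuous_of_disjoint_open (fun ε => (hA ε).1) (hcompl hA) hAd
  obtain ⟨n, hn, hnB⟩ := exists_continuous_of_disjoint_open (fun ε => (hB ε).1) (hcompl hB) hBd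
  have hiff : ∀ (ε₁ ε₂ : ℤˣ) (l : ℕ) (j : ℤ), HasChain (positiveSet (fun t => ((ε₁ : ℤ) : ℝ) * m t)
      (fun t => ((ε₂ : ℤ) : ℝ) * n t) T₁) l j T₂ ↔
        HasChain (fun j => if Even j then A ε₁ else B ε₂) l j τ := by
    intro ε₁ ε₂ l j
    have hset : positiveSet (fun t => ((ε₁ : ℤ) : ℝ) * m t) (fun t => ((ε₂ : ℤ) : ℝ) * n t) T₁ =
        fun j => if Even j then A ε₁ else B ε₂ := by
      funext j
      ext t
      by_cases hj : Even j
      · simp only [positiveSet, parityCoeff, hj, if_true]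
        exact ⟨fun h => (hmA ε₁ t).1 h.2, fun h => ⟨((hA ε₁).2 h).1, (hmA ε₁ t).2 h⟩⟩
      · simp only [positiveSet, parityCoeff, hj, if_false]
        exact ⟨fun h => (hnB ε₂ t).1 h.2, fun h => ⟨((hB ε₂).2 h).1, (hnB ε₂ t).2 h⟩⟩
    rw [hset]
    refine ⟨fun h => ?_, HasChain.mono (fun _ => Subset.rfl) hτ₂.le⟩
    rcases l with _ | l
    · trivial
    · obtain ⟨t, -, ht, h⟩ := h
      refine ⟨t, ?_, ht, h⟩
      have ht' : t ∈ if Even j then A ε₁ else B ε₂ := ht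
      split_ifs at ht'
      · exact ((hA ε₁).2 ht').2
      · exact ((hB ε₂).2 ht').2
  have hcurves : ∀ (ε₁ ε₂ : ℤˣ) (N : ℕ∞), (bySigns s₁ s₂ s₃ s₄ ε₁ ε₂).1.isSome ∧
      (bySigns s₁ s₂ s₃ s₄ ε₁ ε₂).2 = N + 1 →
      HasExactlyCurves T₁ T₂ pL qL m n ε₁ ε₂ (2 * N + 1) := by
    intro ε₁ ε₂ N h
    refine hasExactlyCurves_of_encard_chains hT hp hq hp_pos hq_nonneg hm hn ε₁ ε₂ ?_
    simp only [hiff, hch]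
    exact encard_chain_indices h.1 h.2
  -- At least one alternation occurs in (+, +), so chains of length 1 exist for both kinds; their
  -- points show that neither weight vanishes identically.
  have hone : ∀ j, HasChain (fun j => if Even j then A 1 else B 1) 1 j τ := by
    intro j
    rw [hch]
    have e : bySigns s₁ s₂ s₃ s₄ 1 1 = s₁ := rfl
    simp only [e]
    obtain ⟨o, k⟩ := s₁
    obtain ⟨ho, hk⟩ := h₁
    simp only at ho hk
    subst hk
    match o, ho with
    | some true, _ => split_ifs <;> simp [chainLengths]
    | some false, _ => split_ifs <;> simp [chainLengths]
  refine ⟨m, n, hm.continuousOn, hn.continuousOn, ?_, ?_, hcurves 1 1 p h₁, hcurves 1 (-1) q h₂,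
    hcurves (-1) (-1) r h₄, hcurves (-1) 1 s h₃⟩
  · obtain ⟨t, -, ht₀, -⟩ := hone 0
    have ht : t ∈ if Even (0 : ℤ) then A 1 else B 1 := ht₀
    rw [if_pos Even.zero] at ht
    have hmem := (hA 1).2 ht
    refine ⟨t, ⟨hmem.1.le, (hmem.2.trans hτ₂).le⟩, fun h => ?_⟩
    have := (hmA 1 t).2 ht
    rw [h, mul_zero] at this
    exact this.false
  · obtain ⟨t, -, ht₀, -⟩ := hone 1
    have ht : t ∈ if Even (1 : ℤ) then A 1 else B 1 := ht₀
    rw [if_neg (by decide)] at ht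
    have hmem := (hB 1).2 ht
    refine ⟨t, ⟨hmem.1.le, (hmem.2.trans hτ₂).le⟩, fun h => ?_⟩
    have := (hnB 1 t).2 ht
    rw [h, mul_zero] at this
    exact this.false
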